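/- Let $(A,\mathfrak n)$ be a regular local ring, and let $\mathfrak a=(x_1,\dots,x_d)$ and $\mathfrak b=(y_1,\dots,y_s)$, $s\ge 1$, be ideals of $A$ with $\operatorname{ht}\mathfrak a=d$ ($\mathfrak a$ is a complete intersection) and $\operatorname{ht}\mathfrak b=s-1$ ($\mathfrak b$ is an almost complete intersection; the $y_i$ need not generate $\mathfrak b$ minimally). Suppose that $x_1,\dots,x_d,y_1,\dots,y_{s-1}$ is a regular sequence of $A$ and that $\operatorname{ht}\mathfrak a+\operatorname{ht}\mathfrak b=d+s-1=\dim A$. Put $R:=A/\mathfrak b$ and $R/\mathfrak a:=A/(\mathfrak a+\mathfrak b)$. For a proper ideal $I$ of $A$ let $\omega_{A/I}:=\operatorname{Ext}_A^{\dim A-\dim A/I}(A/I,A)$ denote the canonical module of $A/I$, let $H_i(\mathbf x,M)$ denote the Koszul homology of $\mathbf x=x_1,\dots,x_d$ with coefficients in $M$, and let $\ell$ denote length. Then the following hold. (i) There is an exact sequence $$0\to H_2(\mathbf x,R)\to \omega_R/\mathfrak a\,\omega_R\to \omega_{R/\mathfrak a}\to H_1(\mathbf x,R)\to 0.$$ (ii)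 $H_i(\mathbf x,R)\cong H_{i-2}(\mathbf x,\omega_R)$ for every $i\ge 3$. Moreover, $\operatorname{depth}\omega_R=\operatorname{depth}R+2$ if $\operatorname{depth}R\le d-2$, and $\operatorname{depth}\omega_R=d$ if $\operatorname{depth}R\ge d-1$. (iii) The images of $x_1,\dots,x_d$ in $R$ form a system of parameters of $R$. This system satisfies the Monomial Conjecture, that is, $$x_1^t\cdots x_d^t\notin (x_1^{t+1},\dots,x_d^{t+1})R\quad\text{for every } t\ge 1,$$ if and only if $\ell\big(H_2(\mathbf x,R)\big)<\ell\big(\omega_R/\mathfrak a\,\omega_R\big)$. This is also equivalent to the map $\omega_R/\mathfrak a\,\omega_R\to\omega_{R/\mathfrak a}$ being non-zero, in any exact sequence of the form given in (i). -/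

import Mathlib

universe u

/-- The Koszul differential of `x₁, …, x_d` with coefficients in `M`. A family `m` indexed by the
subsets `S` of `{1, …, d}` stands for the Koszul chain `∑_S e_S ⊗ m S`, where `e_S` is the wedge of
the basis vectors `e_i`, `i ∈ S`, in increasing order. From
`∂ e_S = ∑_{i ∈ S} (-1) ^ #{j ∈ S | j < i} x_i e_{S \ {i}}` one gets the coefficient of `∂ m`
at `e_T`. -/
def koszulDifferential {A : Type*} [CommRing A] {d : ℕ} (x : Fin d → A)
    (M : Type*) [AddCommGroup M] [Module A M] :
    (Finset (Fin d) → M) →ₗ[A] (Finset (Fin d) → M) where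
  toFun m T := ∑ i ∈ Tᶜ, ((-1) ^ (T.filter (· < i)).card * x i) • m (insert i T)
  map_add' m m' := by
    funext T
    simp only [Pi.add_apply, smul_add, Finset.sum_add_distrib]
  map_smul' a m := by
    funext T
    simp only [Pi.smul_apply, RingHom.id_apply, Finset.smul_sum]
    exact Finset.sum_congr rfl fun i _ => smul_comm _ _ _

/-- The Koszul chains of degree `p`: those supported on the subsets with `p` elements. -/
def koszulChains (A : Type*) [CommRing A] (d : ℕ) (M : Type*) [AddCommGroup M] [Module A M]
    (p : ℕ) : Submodule A (Finset (Fin d) → M) where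
  carrier := {m | ∀ S, S.card ≠ p → m S = 0}
  add_mem' hm hm' S hS := by simp [hm S hS, hm' S hS]
  zero_mem' _ _ := rfl
  smul_mem' a _ hm S hS := by simp [hm S hS]

/-- The Koszul cycles of degree `p`. -/
def koszulCycles {A : Type*} [CommRing A] {d : ℕ} (x : Fin d → A)
    (M : Type*) [AddCommGroup M] [Module A M] (p : ℕ) : Submodule A (Finset (Fin d) → M) :=
  koszulChains A d M p ⊓ LinearMap.ker (koszulDifferential x M)

/-- The Koszul boundaries of degree `p`: the images of the chains of degree `p + 1`. -/
def koszulBoundaries {A : Type*} [CommRing A] {d : ℕ} (x : Fin d → A)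
    (M : Type*) [AddCommGroup M] [Module A M] (p : ℕ) : Submodule A (Finset (Fin d) → M) :=
  (koszulChains A d M (p + 1)).map (koszulDifferential x M)

/-- The Koszul differential squares to zero. -/
theorem koszulDifferential_koszulDifferential {A : Type*} [CommRing A] {d : ℕ} (x : Fin d → A)
    (M : Type*) [AddCommGroup M] [Module A M] (m : Finset (Fin d) → M) :
    koszulDifferential x M (koszulDifferential x M m) = 0 := by
  have key : ∀ (T : Finset (Fin d)) (i j : Fin d), i ∉ T → j ∉ T → i < j →
      ((-1 : A) ^ (T.filter (· < i)).card * x i) *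
          ((-1) ^ ((insert i T).filter (· < j)).card * x j) +
        ((-1) ^ (T.filter (· < j)).card * x j) *
          ((-1) ^ ((insert j T).filter (· < i)).card * x i) = 0 := by
    intro T i j hi hj hij
    rw [Finset.filter_insert, Finset.filter_insert, if_pos hij, if_neg hij.not_gt,
      Finset.card_insert_of_notMem (by simp [hi])]
    ring
  funext T
  simp only [koszulDifferential, LinearMap.coe_mk, AddHom.coe_mk, Finset.smul_sum, smul_smul,
    Pi.zero_apply]
  rw [Finset.sum_sigma']
  refine Finset.sum_involution (fun a _ => ⟨a.2, a.1⟩) ?_ ?_ ?_ ?_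
  · rintro ⟨i, j⟩ h
    simp only [Finset.mem_sigma, Finset.mem_compl, Finset.mem_insert, not_or] at h
    obtain ⟨hi, hji, hj⟩ := h
    dsimp only
    rw [Finset.insert_comm, ← add_smul]
    rcases lt_or_gt_of_ne hji with h | h
    · rw [add_comm, key T j i hj hi h, zero_smul]
    · rw [key T i j hi hj h, zero_smul]
  · rintro ⟨i, j⟩ h _ h'
    simp only [Finset.mem_sigma, Finset.mem_compl, Finset.mem_insert, not_or] at h
    simp only [Sigma.mk.injEq] at h'
    exact h.2.1 h'.1
  · rintro ⟨i, j⟩ h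
    simp only [Finset.mem_sigma, Finset.mem_compl, Finset.mem_insert, not_or] at h ⊢
    exact ⟨h.2.2, fun e => h.2.1 e.symm, h.1⟩
  · rintro ⟨i, j⟩ _
    rfl

/-- Boundaries are cycles. -/
theorem koszulBoundaries_le_koszulCycles {A : Type*} [CommRing A] {d : ℕ} (x : Fin d → A)
    (M : Type*) [AddCommGroup M] [Module A M] (p : ℕ) :
    koszulBoundaries x M p ≤ koszulCycles x M p := by
  rintro _ ⟨m, hm, rfl⟩
  refine ⟨fun T hT => ?_, koszulDifferential_koszulDifferential x M m⟩
  refine Finset.sum_eq_zero fun i hi => ?_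
  rw [hm (insert i T) ?_, smul_zero]
  rw [Finset.card_insert_of_notMem (Finset.mem_compl.mp hi)]
  omega

/-- The Koszul homology module `H_p(x₁, …, x_d; M)`. -/
abbrev KoszulHomology {A : Type*} [CommRing A] {d : ℕ} (x : Fin d → A)
    (M : Type*) [AddCommGroup M] [Module A M] (p : ℕ) : Type _ :=
  koszulCycles x M p ⧸ (koszulBoundaries x M p).submoduleOf (koszulCycles x M p)

/-- The depth of a module `M` over a local ring `A`: the supremum of the lengths of the
`M`-regular sequences in the maximal ideal. If `M` is a module over a quotient of `A`, the depth
over the quotient is the same number, as regular sequences can be lifted and mapped down. -/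
noncomputable def moduleDepth (A : Type*) [CommRing A] [IsLocalRing A]
    (M : Type*) [AddCommGroup M] [Module A M] : ℕ∞ :=
  ⨆ rs : {rs : List A // (∀ r ∈ rs, r ∈ IsLocalRing.maximalIdeal A) ∧
    RingTheory.Sequence.IsRegular M rs}, (rs.1.length : ℕ∞)

/-- The number `dim A - dim A/I`, for a nontrivial ring `A` of finite Krull dimension and a proper
ideal `I`. -/
noncomputable def quotientCodim {A : Type*} [CommRing A] (I : Ideal A) : ℕ :=
  ((ringKrullDim A).unbotD 0 - (ringKrullDim (A ⧸ I)).unbotD 0).toNat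

/-- The canonical module of `A ⧸ I`, for a regular local ring `A` and a proper ideal `I`:
`Ext_A^c(A/I, A)` with `c = dim A - dim A/I`. It is killed by `I`, and the module structures over
`A` and over `A ⧸ I` have the same submodules and the same linear maps. -/
noncomputable abbrev CanonicalModule {A : Type u} [CommRing A] (I : Ideal A) : Type u :=
  CategoryTheory.Abelian.Ext.{u} (ModuleCat.of A (A ⧸ I)) (ModuleCat.of A A) (quotientCodim I)

/-- `x₁, …, x_d` is a system of parameters of the local ring `R`. -/
def IsSystemOfParameters {R : Type*} [CommRing R] {d : ℕ} (x : Fin d → R) : Prop :=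
  ringKrullDim R = d ∧
    ∃ _ : IsLocalRing R, (Ideal.span (Set.range x)).radical = IsLocalRing.maximalIdeal R

/-- The sequence `x₁, …, x_d` satisfies the Monomial Conjecture:
`x₁ᵗ ⋯ x_dᵗ ∉ (x₁ᵗ⁺¹, …, x_dᵗ⁺¹)` for every `t ≥ 1`. -/
def SatisfiesMonomialConjecture {R : Type*} [CommRing R] {d : ℕ} (x : Fin d → R) : Prop :=
  ∀ t : ℕ, 1 ≤ t → ∏ i, x i ^ t ∉ Ideal.span (Set.range fun i => x i ^ (t + 1))

/-!
Put `S = A ⧸ (y₁, …, y_{s-1})` and let `l = y_s`. As `S` is Gorenstein and `𝔟` has height `s - 1`,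
the canonical module of `R = S ⧸ l S` is the annihilator of `l` in `S`, so that
`0 → ω_R → S → S → R → 0`, with `l` in the middle, is exact. The sequence `x` is `S`-regular, hence
`H_i(x, S) = 0` for `i > 0`; splicing the long exact sequences of the two halves gives
`H_{i+2}(x, R) ≅ H_i(x, ω_R)` for `i > 0`, and in low degrees the four-term sequence, whose third
term is the kernel of `l` on `S ⧸ 𝔞 S`, that is `ω_{R/𝔞}`. Depth is read off the vanishing of Koszul
homology.

For the Monomial Conjecture, the annihilator of `∏ x_i^t` in the Artinian Gorenstein ring
`T = S ⧸ (x_i^{t+1})` is `𝔞 T`, so by double annihilators `∏ x_i^t ∈ l T` if and only if every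
element of `T` killed by `l` lies in `𝔞 T`. By the Artin-Rees lemma this holds for large `t` exactly
when `ω_R ⊆ 𝔞 S`, that is, when `ω_R ⧸ 𝔞 ω_R → ω_{R/𝔞}` vanishes.
-/

section KoszulChains

variable {A : Type*} [CommRing A] {d : ℕ} (x : Fin d → A)
  {M N P : Type*} [AddCommGroup M] [Module A M] [AddCommGroup N] [Module A N]
  [AddCommGroup P] [Module A P]

theorem koszulDifferential_compLeft (f : M →ₗ[A] N) (m : Finset (Fin d) → M) :
    koszulDifferential x N (f.compLeft _ m) = f.compLeft _ (koszulDifferential x M m) := by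
  funext T
  simp [koszulDifferential]

theorem compLeft_mem_koszulChains (f : M →ₗ[A] N) {p : ℕ} {m : Finset (Fin d) → M}
    (hm : m ∈ koszulChains A d M p) : f.compLeft _ m ∈ koszulChains A d N p := by
  intro S hS
  simp [hm S hS]

theorem koszulDifferential_mem_koszulChains {p : ℕ} {m : Finset (Fin d) → M}
    (hm : m ∈ koszulChains A d M (p + 1)) :
    koszulDifferential x M m ∈ koszulChains A d M p :=
  (koszulBoundaries_le_koszulCycles x M p ⟨m, hm, rfl⟩).1

theorem koszulDifferential_eq_zero_of_mem_koszulChains_zero {m : Finset (Fin d) → M}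
    (hm : m ∈ koszulChains A d M 0) : koszulDifferential x M m = 0 := by
  funext T
  refine Finset.sum_eq_zero fun i _ => ?_
  rw [hm _ (Finset.card_ne_zero_of_mem (Finset.mem_insert_self i T)), smul_zero]

theorem eq_zero_of_mem_koszulChains_of_lt {p : ℕ} (hp : d < p) {m : Finset (Fin d) → M}
    (hm : m ∈ koszulChains A d M p) : m = 0 := by
  funext S
  exact hm S ((S.card_le_univ.trans_eq (Fintype.card_fin d)).trans_lt hp).ne

theorem koszulChains_zero_ext {m n : Finset (Fin d) → M} (hm : m ∈ koszulChains A d M 0)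
    (hn : n ∈ koszulChains A d M 0) (h : m ∅ = n ∅) : m = n := by
  funext S
  by_cases hS : S.card = 0
  · rw [Finset.card_eq_zero.mp hS, h]
  · rw [hm S hS, hn S hS]

theorem single_mem_koszulChains (S : Finset (Fin d)) (v : M) :
    Pi.single S v ∈ koszulChains A d M S.card := by
  intro T hT
  rw [Pi.single_eq_of_ne]
  rintro rfl
  exact hT rfl

theorem exists_koszulChain_lift (f : M →ₗ[A] N) {p : ℕ} {n : Finset (Fin d) → N}
    (hn : n ∈ koszulChains A d N p) (h : ∀ S, n S ∈ LinearMap.range f) :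
    ∃ m ∈ koszulChains A d M p, f.compLeft _ m = n := by
  choose m hm using h
  refine ⟨fun S => if S.card = p then m S else 0, fun S hS => if_neg hS, ?_⟩
  funext S
  by_cases hS : S.card = p
  · simp [hS, hm]
  · simp [hS, hn S hS]

theorem exists_koszulChain_lift_of_surjective {f : M →ₗ[A] N} (hf : Function.Surjective f)
    {p : ℕ} {n : Finset (Fin d) → N} (hn : n ∈ koszulChains A d N p) :
    ∃ m ∈ koszulChains A d M p, f.compLeft _ m = n :=
  exists_koszulChain_lift f hn fun S => hf (n S)

theorem exists_koszulChain_lift_of_exact {f : M →ₗ[A] N} {g : N →ₗ[A] P}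
    (h : Function.Exact f g) {p : ℕ} {n : Finset (Fin d) → N} (hn : n ∈ koszulChains A d N p)
    (hg : g.compLeft _ n = 0) : ∃ m ∈ koszulChains A d M p, f.compLeft _ m = n :=
  exists_koszulChain_lift f hn fun S => (h (n S)).mp (congrFun hg S)

theorem compLeft_injective {f : M →ₗ[A] N} (hf : Function.Injective f) :
    Function.Injective (f.compLeft (Finset (Fin d))) := fun _ _ h =>
  funext fun S => hf (congrFun h S)

theorem compLeft_compLeft_eq_zero {f : M →ₗ[A] N} {g : N →ₗ[A] P} (h : Function.Exact f g)
    (m : Finset (Fin d) → M) : g.compLeft _ (f.compLeft _ m) = 0 :=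
  funext fun S => h.apply_apply_eq_zero (m S)

theorem mem_koszulCycles_iff {p : ℕ} {m : Finset (Fin d) → M} :
    m ∈ koszulCycles x M p ↔ m ∈ koszulChains A d M p ∧ koszulDifferential x M m = 0 :=
  Iff.rfl

theorem mem_koszulCycles_of_compLeft {f : M →ₗ[A] N} (hf : Function.Injective f) {p : ℕ}
    {m : Finset (Fin d) → M} (hm : m ∈ koszulChains A d M p)
    (hfm : koszulDifferential x N (f.compLeft _ m) = 0) : m ∈ koszulCycles x M p :=
  ⟨hm, compLeft_injective hf (by rw [← koszulDifferential_compLeft, hfm, map_zero])⟩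

theorem compLeft_mem_koszulCycles (f : M →ₗ[A] N) {p : ℕ} {m : Finset (Fin d) → M}
    (hm : m ∈ koszulCycles x M p) : f.compLeft _ m ∈ koszulCycles x N p :=
  (mem_koszulCycles_iff x).mpr ⟨compLeft_mem_koszulChains f hm.1, by
    rw [koszulDifferential_compLeft, ((mem_koszulCycles_iff x).mp hm).2, map_zero]⟩

end KoszulChains

theorem exists_linearMap_apply_eq_of_factorsThrough {A Z P Q : Type*} [Semiring A]
    [AddCommMonoid Z] [Module A Z] [AddCommMonoid P] [Module A P] [AddCommMonoid Q] [Module A Q]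
    {φ : Z →ₗ[A] P} {ψ : Z →ₗ[A] Q} (hφ : Function.Surjective φ) (h : Function.FactorsThrough ψ φ) :
    ∃ f : P →ₗ[A] Q, ∀ z, f (φ z) = ψ z := by
  have hψ : ∀ z, ψ (Function.surjInv hφ (φ z)) = ψ z := fun z => h (Function.surjInv_eq hφ _)
  refine ⟨{ toFun := fun p => ψ (Function.surjInv hφ p), map_add' := ?_, map_smul' := ?_ }, hψ⟩
  · refine hφ.forall₂.mpr fun z w => ?_
    rw [← map_add, hψ, hψ, hψ, map_add]
  · refine fun a => hφ.forall.mpr fun z => ?_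
    rw [← map_smul, hψ, hψ, map_smul, RingHom.id_apply]

namespace KoszulHomology

variable {A : Type*} [CommRing A] {d : ℕ} (x : Fin d → A)

section Classes

variable (M : Type*) [AddCommGroup M] [Module A M] (p : ℕ)

/-- The homology class of a Koszul cycle. -/
def mk : koszulCycles x M p →ₗ[A] KoszulHomology x M p :=
  Submodule.mkQ _

theorem mk_surjective : Function.Surjective (mk x M p) :=
  Submodule.mkQ_surjective _

variable {M p}

theorem mk_eq_zero_iff (m : koszulCycles x M p) :
    mk x M p m = 0 ↔ ∃ c ∈ koszulChains A d M (p + 1), koszulDifferential x M c = m :=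
  Submodule.Quotient.mk_eq_zero _

theorem subsingleton_iff :
    Subsingleton (KoszulHomology x M p) ↔ ∀ m ∈ koszulChains A d M p,
      koszulDifferential x M m = 0 → ∃ c ∈ koszulChains A d M (p + 1),
        koszulDifferential x M c = m := by
  rw [Submodule.Quotient.subsingleton_iff, Submodule.submoduleOf,
    Submodule.comap_subtype_eq_top]
  exact ⟨fun h m hm hm' => h ⟨hm, hm'⟩, fun h m hm => h m hm.1 hm.2⟩

variable (M) in
theorem subsingleton_of_lt (hp : d < p) : Subsingleton (KoszulHomology x M p) :=
  (subsingleton_iff x).mpr fun m hm _ =>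
    ⟨0, zero_mem _, by rw [map_zero, eq_zero_of_mem_koszulChains_of_lt hp hm]⟩

end Classes

section Functoriality

variable {M N P : Type*} [AddCommGroup M] [Module A M] [AddCommGroup N] [Module A N]
  [AddCommGroup P] [Module A P]

/-- The map induced on Koszul homology by a linear map of the coefficients. -/
def map (f : M →ₗ[A] N) (p : ℕ) : KoszulHomology x M p →ₗ[A] KoszulHomology x N p :=
  Submodule.mapQ _ _ ((f.compLeft _).restrict fun _ => compLeft_mem_koszulCycles x f) <| by
    rintro ⟨_, _⟩ ⟨c, hc, rfl⟩
    exact ⟨f.compLeft _ c, compLeft_mem_koszulChains f hc, koszulDifferential_compLeft x f c⟩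

theorem map_mk (f : M →ₗ[A] N) {p : ℕ} (m : koszulCycles x M p) :
    map x f p (mk x M p m) =
      mk x N p ⟨f.compLeft _ m, compLeft_mem_koszulCycles x f m.2⟩ :=
  rfl

theorem map_comp_apply (g : N →ₗ[A] P) (f : M →ₗ[A] N) {p : ℕ} (h : KoszulHomology x M p) :
    map x (g ∘ₗ f) p h = map x g p (map x f p h) := by
  obtain ⟨m, rfl⟩ := mk_surjective x M p h
  rfl

theorem map_lsmul_apply (a : A) {p : ℕ} (h : KoszulHomology x M p) :
    map x (LinearMap.lsmul A M a) p h = a • h := by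
  obtain ⟨m, rfl⟩ := mk_surjective x M p h
  rfl

variable {f : M →ₗ[A] N} {g : N →ₗ[A] P}

theorem exact_map_map (hf : Function.Injective f) (hfg : Function.Exact f g)
    (hg : Function.Surjective g) (p : ℕ) : Function.Exact (map x f p) (map x g p) := by
  intro h
  constructor
  · obtain ⟨n, rfl⟩ := mk_surjective x N p h
    intro hn
    obtain ⟨c, hc, hcn⟩ := (mk_eq_zero_iff x _).mp hn
    obtain ⟨b, hb, rfl⟩ := exists_koszulChain_lift_of_surjective hg hc
    obtain ⟨m, hm, hmn⟩ := exists_koszulChain_lift_of_exact hfg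
      (sub_mem n.2.1 (koszulDifferential_mem_koszulChains x hb))
      (by rw [map_sub, ← koszulDifferential_compLeft, hcn]; exact sub_self _)
    have hmc : m ∈ koszulCycles x M p := mem_koszulCycles_of_compLeft x hf hm <| by
      rw [hmn, map_sub, koszulDifferential_koszulDifferential, sub_zero]
      exact n.2.2
    refine ⟨mk x M p ⟨m, hmc⟩, ?_⟩
    rw [map_mk, eq_comm, ← sub_eq_zero, ← map_sub, mk_eq_zero_iff]
    exact ⟨b, hb, by simp [hmn]⟩
  · rintro ⟨h, rfl⟩
    obtain ⟨m, rfl⟩ := mk_surjective x M p h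
    rw [map_mk, map_mk, mk_eq_zero_iff]
    exact ⟨0, zero_mem _, by rw [map_zero]; exact (compLeft_compLeft_eq_zero hfg m.1).symm⟩

variable (f g) in
/-- The connecting relation of the Koszul complexes of `M → N → P`: a cycle `c` of `P` is related to
a cycle `m` of `M` if `c` lifts to a chain of `N` whose differential is the image of `m`. -/
def connectingRel (p : ℕ) : Submodule A (koszulCycles x P (p + 1) × koszulCycles x M p) where
  carrier := {z | ∃ n ∈ koszulChains A d N (p + 1),
    g.compLeft _ n = z.1 ∧ koszulDifferential x N n = f.compLeft _ z.2}
  add_mem' := by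
    rintro _ _ ⟨n, hn, hnc, hnm⟩ ⟨n', hn', hnc', hnm'⟩
    exact ⟨n + n', add_mem hn hn', by simp [hnc, hnc'], by simp [hnm, hnm']⟩
  zero_mem' := ⟨0, zero_mem _, by simp, by simp⟩
  smul_mem' := by
    rintro a _ ⟨n, hn, hnc, hnm⟩
    exact ⟨a • n, Submodule.smul_mem _ a hn, by simp [hnc], by simp [hnm]⟩

variable (hf : Function.Injective f) (hfg : Function.Exact f g) (hg : Function.Surjective g)

include hf hfg hg

theorem exists_mem_connectingRel {p : ℕ} (c : koszulCycles x P (p + 1)) :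
    ∃ m, (c, m) ∈ connectingRel x f g p := by
  obtain ⟨n, hn, hnc⟩ := exists_koszulChain_lift_of_surjective hg c.2.1
  obtain ⟨m, hm, hmn⟩ := exists_koszulChain_lift_of_exact hfg
    (koszulDifferential_mem_koszulChains x hn)
    (by rw [← koszulDifferential_compLeft, hnc]; exact c.2.2)
  refine ⟨⟨m, mem_koszulCycles_of_compLeft x hf hm ?_⟩, n, hn, hnc, hmn.symm⟩
  rw [hmn, koszulDifferential_koszulDifferential]

theorem mk_eq_zero_of_mem_connectingRel {p : ℕ} {c : koszulCycles x P (p + 1)}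
    {m : koszulCycles x M p} (h : (c, m) ∈ connectingRel x f g p) (hc : mk x P (p + 1) c = 0) :
    mk x M p m = 0 := by
  obtain ⟨n, hn, hnc, hnm⟩ := h
  obtain ⟨b, hb, hbc⟩ := (mk_eq_zero_iff x c).mp hc
  obtain ⟨a, ha, rfl⟩ := exists_koszulChain_lift_of_surjective hg hb
  obtain ⟨e, he, hen⟩ := exists_koszulChain_lift_of_exact hfg
    (sub_mem hn (koszulDifferential_mem_koszulChains x ha))
    (by rw [map_sub, ← koszulDifferential_compLeft, hbc, hnc, sub_self])
  refine (mk_eq_zero_iff x m).mpr ⟨e, he, compLeft_injective hf ?_⟩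
  rw [← koszulDifferential_compLeft, hen, map_sub, koszulDifferential_koszulDifferential,
    sub_zero, hnm]

theorem exists_connecting_mk_eq (p : ℕ) :
    ∃ δ : KoszulHomology x P (p + 1) →ₗ[A] KoszulHomology x M p,
      ∀ c m, (c, m) ∈ connectingRel x f g p → δ (mk x P (p + 1) c) = mk x M p m := by
  let φ : connectingRel x f g p →ₗ[A] KoszulHomology x P (p + 1) :=
    mk x P (p + 1) ∘ₗ LinearMap.fst A _ _ ∘ₗ Submodule.subtype _
  let ψ : connectingRel x f g p →ₗ[A] KoszulHomology x M p :=
    mk x M p ∘ₗ LinearMap.snd A _ _ ∘ₗ Submodule.subtype _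
  have hφ : Function.Surjective φ := fun h => by
    obtain ⟨c, rfl⟩ := mk_surjective x P (p + 1) h
    obtain ⟨m, hm⟩ := exists_mem_connectingRel x hf hfg hg c
    exact ⟨⟨(c, m), hm⟩, rfl⟩
  have hψ : Function.FactorsThrough ψ φ := fun z w hzw => by
    rw [← sub_eq_zero, ← map_sub] at hzw ⊢
    exact mk_eq_zero_of_mem_connectingRel x hf hfg hg (z - w).2 hzw
  exact (exists_linearMap_apply_eq_of_factorsThrough hφ hψ).imp fun δ hδ c m h => hδ ⟨(c, m), h⟩

theorem exists_exact_connecting (p : ℕ) :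
    ∃ δ : KoszulHomology x P (p + 1) →ₗ[A] KoszulHomology x M p,
      Function.Exact (map x g (p + 1)) δ ∧ Function.Exact δ (map x f p) := by
  obtain ⟨δ, hδ⟩ := exists_connecting_mk_eq x hf hfg hg p
  refine ⟨δ, fun h => ⟨?_, ?_⟩, fun h => ⟨?_, ?_⟩⟩
  · obtain ⟨c, rfl⟩ := mk_surjective x P (p + 1) h
    obtain ⟨m, hcm⟩ := exists_mem_connectingRel x hf hfg hg c
    rw [hδ c m hcm, mk_eq_zero_iff]
    rintro ⟨b, hb, hbm⟩
    obtain ⟨n, hn, hnc, hnm⟩ := hcm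
    refine ⟨mk x N (p + 1) ⟨n - f.compLeft _ b, (mem_koszulCycles_iff x).mpr
      ⟨sub_mem hn (compLeft_mem_koszulChains f hb), ?_⟩⟩, ?_⟩
    · rw [map_sub, koszulDifferential_compLeft, hbm, hnm, sub_self]
    · rw [map_mk]
      congr 2
      rw [map_sub, compLeft_compLeft_eq_zero hfg, sub_zero, hnc]
  · rintro ⟨h, rfl⟩
    obtain ⟨n, rfl⟩ := mk_surjective x N (p + 1) h
    rw [map_mk, hδ _ 0 ⟨n, n.2.1, rfl, by simpa using n.2.2⟩, map_zero]
  · obtain ⟨m, rfl⟩ := mk_surjective x M p h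
    rw [map_mk, mk_eq_zero_iff]
    rintro ⟨n, hn, hnm⟩
    have hgn : g.compLeft _ n ∈ koszulCycles x P (p + 1) :=
      (mem_koszulCycles_iff x).mpr ⟨compLeft_mem_koszulChains g hn, by
        rw [koszulDifferential_compLeft, hnm]; exact compLeft_compLeft_eq_zero hfg m.1⟩
    exact ⟨mk x P (p + 1) ⟨_, hgn⟩, hδ _ m ⟨n, hn, rfl, hnm⟩⟩
  · rintro ⟨h, rfl⟩
    obtain ⟨c, rfl⟩ := mk_surjective x P (p + 1) h
    obtain ⟨m, hcm⟩ := exists_mem_connectingRel x hf hfg hg c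
    rw [hδ c m hcm, map_mk, mk_eq_zero_iff]
    obtain ⟨n, hn, -, hnm⟩ := hcm
    exact ⟨n, hn, hnm⟩

end Functoriality

end KoszulHomology

section Homotopy

variable {A : Type*} [CommRing A] {d : ℕ} (x : Fin d → A)
  {M : Type*} [AddCommGroup M] [Module A M]

theorem koszulDifferential_apply_eq_sum_compl (m : Finset (Fin d) → M) (T : Finset (Fin d)) :
    koszulDifferential x M m T =
      ∑ i ∈ Tᶜ, ((-1) ^ (T.filter (· < i)).card * x i) • m (insert i T) :=
  rfl

variable (A) in
/-- Exterior multiplication of Koszul chains by the basis vector `e_j`, for the sign convention of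
`koszulDifferential`. -/
def koszulWedge (j : Fin d) (m : Finset (Fin d) → M) (T : Finset (Fin d)) : M :=
  if j ∈ T then (-1 : A) ^ (T.filter (· < j)).card • m (T.erase j) else 0

theorem koszulWedge_apply_of_notMem {j : Fin d} (m : Finset (Fin d) → M) {T : Finset (Fin d)}
    (hj : j ∉ T) : koszulWedge A j m T = 0 :=
  if_neg hj

theorem koszulWedge_apply_insert {j : Fin d} (m : Finset (Fin d) → M) {T : Finset (Fin d)}
    (hj : j ∉ T) :
    koszulWedge A j m (insert j T) = (-1 : A) ^ (T.filter (· < j)).card • m T := by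
  rw [koszulWedge, if_pos (Finset.mem_insert_self j T), Finset.erase_insert hj,
    Finset.filter_insert, if_neg (lt_irrefl j)]

theorem koszulWedge_mem_koszulChains (j : Fin d) {p : ℕ} {m : Finset (Fin d) → M}
    (hm : m ∈ koszulChains A d M p) : koszulWedge A j m ∈ koszulChains A d M (p + 1) := by
  intro T hT
  by_cases hj : j ∈ T
  · rw [koszulWedge, if_pos hj, hm, smul_zero]
    rw [← Finset.card_erase_add_one hj] at hT
    omega
  · exact koszulWedge_apply_of_notMem m hj

/-- The two orders in which `e_i` and `e_j` are inserted into `e_T` differ by a sign. -/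
theorem neg_one_pow_card_filter_insert {T : Finset (Fin d)} {i j : Fin d} (hij : i ≠ j)
    (hi : i ∉ T) (hj : j ∉ T) :
    (-1 : A) ^ ((insert j T).filter (· < i)).card * (-1) ^ ((insert i T).filter (· < j)).card =
      -((-1) ^ (T.filter (· < j)).card * (-1) ^ (T.filter (· < i)).card) := by
  rcases lt_or_gt_of_ne hij with h | h
  · rw [Finset.filter_insert, if_neg h.not_gt, Finset.filter_insert, if_pos h,
      Finset.card_insert_of_notMem (by simp [hi])]
    ring
  · rw [Finset.filter_insert, if_pos h, Finset.filter_insert, if_neg h.not_gt,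
      Finset.card_insert_of_notMem (by simp [hj])]
    ring

theorem koszulDifferential_koszulWedge (j : Fin d) (m : Finset (Fin d) → M) :
    koszulDifferential x M (koszulWedge A j m) =
      x j • m - koszulWedge A j (koszulDifferential x M m) := by
  have sign_mul_self (k : ℕ) : (-1 : A) ^ k * (-1) ^ k = 1 := by
    rw [← mul_pow, neg_one_mul, neg_neg, one_pow]
  funext T
  rw [koszulDifferential_apply_eq_sum_compl, Pi.sub_apply, Pi.smul_apply]
  by_cases hj : j ∈ T
  · obtain ⟨T, hjT, rfl⟩ : ∃ U, j ∉ U ∧ T = insert j U :=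
      ⟨T.erase j, Finset.notMem_erase j T, (Finset.insert_erase hj).symm⟩
    have hT : Tᶜ = insert j (insert j T)ᶜ := by
      rw [← Finset.compl_erase, Finset.erase_insert hjT]
    rw [koszulWedge_apply_insert _ hjT, koszulDifferential_apply_eq_sum_compl, hT,
      Finset.sum_insert (by simp), smul_add, smul_smul, ← mul_assoc, sign_mul_self, one_mul,
      sub_add_cancel_left, Finset.smul_sum, ← Finset.sum_neg_distrib]
    refine Finset.sum_congr rfl fun i hi => ?_
    obtain ⟨hij, hiT⟩ : i ≠ j ∧ i ∉ T := by simpa using hi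
    rw [Finset.insert_comm, koszulWedge_apply_insert _ (by simp [hij.symm, hjT]), smul_smul,
      smul_smul, ← neg_smul, mul_right_comm, neg_one_pow_card_filter_insert hij hiT hjT]
    ring_nf
  · rw [koszulWedge_apply_of_notMem _ hj, sub_zero,
      Finset.sum_eq_single_of_mem j (Finset.mem_compl.mpr hj), koszulWedge_apply_insert _ hj,
      smul_smul, mul_right_comm, sign_mul_self, one_mul]
    intro i _ hij
    rw [koszulWedge_apply_of_notMem _ (by simp [hij.symm, hj]), smul_zero]

end Homotopy

namespace KoszulHomology

variable {A : Type*} [CommRing A] {d : ℕ} (x : Fin d → A)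
  (M : Type*) [AddCommGroup M] [Module A M]

theorem smul_eq_zero_of_mem {a : A}
    (ha : a ∈ Ideal.span (Set.range x) ⊔ Module.annihilator A M) {p : ℕ}
    (h : KoszulHomology x M p) : a • h = 0 := by
  obtain ⟨m, rfl⟩ := mk_surjective x M p h
  obtain ⟨b, hb, c, hc, rfl⟩ := Submodule.mem_sup.mp ha
  have hcm : c • m = 0 := Subtype.ext (funext fun S => Module.mem_annihilator.mp hc (m.1 S))
  rw [add_smul, ← map_smul _ c, hcm, map_zero, add_zero]
  refine Submodule.span_induction (p := fun b _ => b • mk x M p m = 0) ?_ (zero_smul A _)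
    (fun a b _ _ ha hb => by rw [add_smul, ha, hb, add_zero])
    (fun a b _ hb => by rw [smul_assoc, hb, smul_zero]) hb
  rintro _ ⟨j, rfl⟩
  rw [← map_smul, mk_eq_zero_iff]
  refine ⟨koszulWedge A j m, koszulWedge_mem_koszulChains j m.2.1, ?_⟩
  have hm : koszulDifferential x M m = 0 := m.2.2
  rw [koszulDifferential_koszulWedge, hm, Submodule.coe_smul, sub_eq_self]
  funext T
  simp [koszulWedge]

variable {M}

theorem isSMulRegular_of_subsingleton_quotSMulTop {r : A} (hr : IsSMulRegular M r) {p : ℕ}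
    (h : Subsingleton (KoszulHomology x (QuotSMulTop r M) (p + 1))) :
    IsSMulRegular (KoszulHomology x M p) r := by
  obtain ⟨δ, -, hδ⟩ := exists_exact_connecting x (f := LinearMap.lsmul A M r) hr
    (LinearMap.exact_lsmul_mkQ_smul_top M r)
    (Submodule.mkQ_surjective _) p
  have hinj : Function.Injective (map x (LinearMap.lsmul A M r) p) :=
    (injective_iff_map_eq_zero _).mpr fun h₀ h₀r => by
      obtain ⟨c, rfl⟩ := (hδ h₀).mp h₀r
      rw [Subsingleton.elim c 0, map_zero]
  exact fun a b hab => hinj (by simpa only [map_lsmul_apply] using hab)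

theorem subsingleton_of_subsingleton_quotSMulTop {r : A} (hr : IsSMulRegular M r)
    (hrad : r ∈ (Ideal.span (Set.range x) ⊔ Module.annihilator A M).radical) {p : ℕ}
    (h : Subsingleton (KoszulHomology x (QuotSMulTop r M) (p + 1))) :
    Subsingleton (KoszulHomology x M p) := by
  obtain ⟨n, hn⟩ := hrad
  refine subsingleton_of_forall_eq 0 fun c => ?_
  refine (isSMulRegular_of_subsingleton_quotSMulTop x hr h).pow n ?_
  dsimp only
  rw [smul_eq_zero_of_mem x M hn, smul_zero]

theorem subsingleton_of_isWeaklyRegular {rs : List A}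
    (hrs : ∀ r ∈ rs, r ∈ (Ideal.span (Set.range x) ⊔ Module.annihilator A M).radical)
    (h : RingTheory.Sequence.IsWeaklyRegular M rs) {p : ℕ} (hp : d < p + rs.length) :
    Subsingleton (KoszulHomology x M p) := by
  induction rs generalizing M p with
  | nil => exact subsingleton_of_lt x M (by simpa using hp)
  | cons r rs ih =>
    rw [RingTheory.Sequence.isWeaklyRegular_cons_iff] at h
    have hann : Module.annihilator A M ≤ Module.annihilator A (QuotSMulTop r M) :=
      LinearMap.annihilator_le_of_surjective _ (Submodule.mkQ_surjective _)
    refine subsingleton_of_subsingleton_quotSMulTop x h.1 (hrs r List.mem_cons_self)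
      (ih (fun s hs => ?_) h.2 (by simp at hp; omega))
    exact Ideal.radical_mono (sup_le_sup_left hann _) (hrs s (List.mem_cons_of_mem r hs))

theorem subsingleton_of_isWeaklyRegular_ofFn
    (h : RingTheory.Sequence.IsWeaklyRegular M (List.ofFn x)) {p : ℕ} (hp : p ≠ 0) :
    Subsingleton (KoszulHomology x M p) := by
  refine subsingleton_of_isWeaklyRegular x (fun r hr => Ideal.le_radical (le_sup_left (α := Ideal A)
    (Ideal.subset_span ?_))) h (by rw [List.length_ofFn]; omega)
  simpa [List.mem_ofFn] using hr

theorem subsingleton_quotSMulTop_succ {r : A} (hr : IsSMulRegular M r) {p : ℕ}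
    (h : Subsingleton (KoszulHomology x M p)) (h' : Subsingleton (KoszulHomology x M (p + 1))) :
    Subsingleton (KoszulHomology x (QuotSMulTop r M) (p + 1)) := by
  obtain ⟨δ, hδ, -⟩ := exists_exact_connecting x (f := LinearMap.lsmul A M r) hr
    (LinearMap.exact_lsmul_mkQ_smul_top M r)
    (Submodule.mkQ_surjective _) p
  refine subsingleton_of_forall_eq 0 fun c => ?_
  obtain ⟨b, rfl⟩ := (hδ c).mp (Subsingleton.elim _ _)
  rw [Subsingleton.elim b 0, map_zero]

end KoszulHomology

section KoszulZero

variable {A : Type*} [CommRing A] {d : ℕ} (x : Fin d → A)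
  {M N : Type*} [AddCommGroup M] [Module A M] [AddCommGroup N] [Module A N]

theorem mem_span_smul_top_iff_exists_koszulDifferential_eq (v : M) :
    v ∈ (Ideal.span (Set.range x) • ⊤ : Submodule A M) ↔
      ∃ c ∈ koszulChains A d M 1, koszulDifferential x M c ∅ = v := by
  constructor
  · intro hv
    induction hv using Submodule.smul_induction_on' with
    | smul a ha w _ =>
      obtain ⟨r, rfl⟩ := Ideal.mem_span_range_iff_exists_fun.mp ha
      refine ⟨fun S => if S.card = 1 then ∑ i ∈ S, r i • w else 0, fun S hS => if_neg hS, ?_⟩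
      rw [koszulDifferential_apply_eq_sum_compl, Finset.sum_smul, Finset.compl_empty]
      refine Finset.sum_congr rfl fun i _ => ?_
      simp [smul_smul, mul_comm]
    | add a _ b _ ha hb =>
      obtain ⟨c, hc, rfl⟩ := ha
      obtain ⟨c', hc', rfl⟩ := hb
      exact ⟨c + c', add_mem hc hc', by simp⟩
  · rintro ⟨c, -, rfl⟩
    rw [koszulDifferential_apply_eq_sum_compl]
    refine Submodule.sum_mem _ fun i _ => Submodule.smul_mem_smul ?_ trivial
    exact Ideal.mul_mem_left _ _ (Ideal.subset_span (Set.mem_range_self i))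

namespace KoszulHomology

theorem single_empty_mem_koszulCycles (v : M) :
    LinearMap.single A (fun _ => M) ∅ v ∈ koszulCycles x M 0 :=
  (mem_koszulCycles_iff x).mpr ⟨single_mem_koszulChains ∅ v,
    koszulDifferential_eq_zero_of_mem_koszulChains_zero x (single_mem_koszulChains ∅ v)⟩

variable (M) in
/-- The surjection `m ↦ [m]` of `M` onto `H₀(x; M)`, with kernel `(x) M`. -/
def zeroMk : M →ₗ[A] KoszulHomology x M 0 :=
  mk x M 0 ∘ₗ (LinearMap.single A (fun _ => M) ∅).codRestrict _ (single_empty_mem_koszulCycles x)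

theorem zeroMk_surjective : Function.Surjective (zeroMk x M) := by
  intro h
  obtain ⟨m, rfl⟩ := mk_surjective x M 0 h
  refine ⟨m.1 ∅, congrArg _ (Subtype.ext ?_)⟩
  exact koszulChains_zero_ext (single_mem_koszulChains ∅ _) m.2.1 (by simp)

theorem zeroMk_eq_zero_iff {v : M} :
    zeroMk x M v = 0 ↔ v ∈ (Ideal.span (Set.range x) • ⊤ : Submodule A M) := by
  rw [mem_span_smul_top_iff_exists_koszulDifferential_eq]
  refine (mk_eq_zero_iff x _).trans (exists_congr fun c => and_congr_right fun hc => ?_)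
  refine ⟨fun h => by simp [h], fun h => ?_⟩
  exact koszulChains_zero_ext (koszulDifferential_mem_koszulChains x hc)
    (single_mem_koszulChains ∅ v) (by simp [h])

theorem map_zeroMk (f : M →ₗ[A] N) (v : M) : map x f 0 (zeroMk x M v) = zeroMk x N (f v) := by
  refine congrArg (mk x N 0) (Subtype.ext (funext fun S => ?_))
  exact Pi.apply_single (fun _ => f) (fun _ => map_zero f) ∅ v S

variable (M) in
/-- `H₀(x; M) = M / (x) M`. -/
noncomputable def zeroEquiv :
    (M ⧸ (Ideal.span (Set.range x) • ⊤ : Submodule A M)) ≃ₗ[A] KoszulHomology x M 0 :=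
  Submodule.quotEquivOfEq _ _ (Submodule.ext fun _ => (zeroMk_eq_zero_iff x).symm) ≪≫ₗ
    (zeroMk x M).quotKerEquivOfSurjective (zeroMk_surjective x)

theorem map_zero_surjective {f : M →ₗ[A] N} (hf : Function.Surjective f) :
    Function.Surjective (map x f 0) := by
  refine (zeroMk_surjective x).forall.mpr (hf.forall.mpr fun v => ⟨zeroMk x M v, map_zeroMk x f v⟩)

theorem map_zero_eq_zero_iff {f : M →ₗ[A] N} :
    map x f 0 = 0 ↔ ∀ m, f m ∈ (Ideal.span (Set.range x) • ⊤ : Submodule A N) := by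
  simp only [LinearMap.ext_iff, (zeroMk_surjective x).forall, map_zeroMk, LinearMap.zero_apply,
    zeroMk_eq_zero_iff]

end KoszulHomology

end KoszulZero

namespace KoszulHomology

section Splicing

variable {A : Type*} [CommRing A] {d : ℕ} (x : Fin d → A)
  {W F G R : Type*} [AddCommGroup W] [Module A W] [AddCommGroup F] [Module A F]
  [AddCommGroup G] [Module A G] [AddCommGroup R] [Module A R]
  {ι : W →ₗ[A] F} {l : F →ₗ[A] G} {π : G →ₗ[A] R}

theorem injective_of_exact_map_of_subsingleton {p : ℕ} {δ : KoszulHomology x R p →ₗ[A] W}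
    (h : Function.Exact (map x π p) δ) (hG : Subsingleton (KoszulHomology x G p)) :
    Function.Injective δ := by
  refine (injective_iff_map_eq_zero δ).mpr fun c hc => ?_
  obtain ⟨b, rfl⟩ := (h c).mp hc
  rw [Subsingleton.elim b 0, map_zero]

theorem exists_injective_exact_map (hι : Function.Injective ι) (hιl : Function.Exact ι l)
    (hlπ : Function.Exact l π) (hπ : Function.Surjective π)
    (hF : ∀ p ≠ 0, Subsingleton (KoszulHomology x F p))
    (hG : ∀ p ≠ 0, Subsingleton (KoszulHomology x G p)) (p : ℕ) :
    ∃ f : KoszulHomology x R (p + 2) →ₗ[A] KoszulHomology x W p,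
      Function.Injective f ∧ Function.Exact f (map x ι p) := by
  obtain ⟨δ₁, hδ₁, hδ₁'⟩ := exists_exact_connecting x (f := l.range.subtype)
    l.range.injective_subtype (fun v => (hlπ v).trans (by simp)) hπ (p + 1)
  obtain ⟨δ₂, hδ₂, hδ₂'⟩ := exists_exact_connecting x (g := l.rangeRestrict) hι
    (fun v => Subtype.ext_iff.trans (hιl v)) l.surjective_rangeRestrict p
  have hδ₁s : Function.Surjective δ₁ := fun c =>
    have := hG (p + 1) p.succ_ne_zero
    (hδ₁' c).mp (Subsingleton.elim _ _)
  refine ⟨δ₂ ∘ₗ δ₁, ?_, fun w => (hδ₂' w).trans (hδ₁s.exists (p := fun c => δ₂ c = w))⟩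
  exact (injective_of_exact_map_of_subsingleton x hδ₂ (hF _ (by omega))).comp
    (injective_of_exact_map_of_subsingleton x hδ₁ (hG _ (by omega)))

theorem nonempty_equiv_add_two (hι : Function.Injective ι) (hιl : Function.Exact ι l)
    (hlπ : Function.Exact l π) (hπ : Function.Surjective π)
    (hF : ∀ p ≠ 0, Subsingleton (KoszulHomology x F p))
    (hG : ∀ p ≠ 0, Subsingleton (KoszulHomology x G p)) {p : ℕ} (hp : p ≠ 0) :
    Nonempty (KoszulHomology x R (p + 2) ≃ₗ[A] KoszulHomology x W p) := by
  obtain ⟨f, hf, hfι⟩ := exists_injective_exact_map x hι hιl hlπ hπ hF hG p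
  have := hF p hp
  exact ⟨.ofBijective f ⟨hf, fun w => (hfι w).mp (Subsingleton.elim _ _)⟩⟩

theorem exists_surjective_exact_map_zero (hιl : Function.Exact ι l)
    (hι : Function.Injective ι) (hlπ : Function.Exact l π) (hπ : Function.Surjective π)
    (hG : Subsingleton (KoszulHomology x G 1)) :
    ∃ h : LinearMap.ker (map x l 0) →ₗ[A] KoszulHomology x R 1, Function.Surjective h ∧
      ∀ k, h k = 0 ↔ ∃ w, map x ι 0 w = k := by
  obtain ⟨δ, hδ, hδ'⟩ := exists_exact_connecting x (f := l.range.subtype)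
    l.range.injective_subtype (fun v => (hlπ v).trans (by simp)) hπ 0
  have hδi := injective_of_exact_map_of_subsingleton x hδ hG
  have hmap (k : KoszulHomology x F 0) :
      map x l.range.subtype 0 (map x l.rangeRestrict 0 k) = map x l 0 k :=
    (map_comp_apply x l.range.subtype l.rangeRestrict k).symm
  let ψ : LinearMap.ker (map x l 0) →ₗ[A] LinearMap.range δ :=
    (map x l.rangeRestrict 0 ∘ₗ Submodule.subtype _).codRestrict _ fun k =>
      (hδ' _).mp ((hmap k).trans k.2)
  let ε := LinearEquiv.ofInjective δ hδi
  refine ⟨ε.symm ∘ₗ ψ, ε.symm.surjective.comp ?_, fun k => ?_⟩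
  · rintro ⟨c, hc⟩
    obtain ⟨k, rfl⟩ := map_zero_surjective x l.surjective_rangeRestrict c
    exact ⟨⟨k, (hmap k).symm.trans ((hδ' _).mpr hc)⟩, rfl⟩
  · refine (LinearEquiv.map_eq_zero_iff ε.symm).trans (Subtype.ext_iff.trans ?_)
    exact exact_map_map x hι (fun v => Subtype.ext_iff.trans (hιl v)) l.surjective_rangeRestrict 0 k

theorem exists_four_term_exact (hι : Function.Injective ι) (hιl : Function.Exact ι l)
    (hlπ : Function.Exact l π) (hπ : Function.Surjective π)
    (hF : ∀ p ≠ 0, Subsingleton (KoszulHomology x F p))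
    (hG : ∀ p ≠ 0, Subsingleton (KoszulHomology x G p))
    {U V : Type*} [AddCommGroup U] [Module A U] [AddCommGroup V] [Module A V]
    (e : U ≃ₗ[A] KoszulHomology x W 0) (ε : V ≃ₗ[A] LinearMap.ker (map x l 0)) :
    ∃ (f : KoszulHomology x R 2 →ₗ[A] U) (g : U →ₗ[A] V) (h : V →ₗ[A] KoszulHomology x R 1),
      Function.Injective f ∧ Function.Exact f g ∧ Function.Exact g h ∧ Function.Surjective h := by
  obtain ⟨f, hf, hfι⟩ := exists_injective_exact_map x hι hιl hlπ hπ hF hG 0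
  obtain ⟨h, hh, hhι⟩ := exists_surjective_exact_map_zero x hιl hι hlπ hπ (hG 1 one_ne_zero)
  have hzero (w : KoszulHomology x W 0) : map x l 0 (map x ι 0 w) = 0 := by
    obtain ⟨m, rfl⟩ := zeroMk_surjective x w
    rw [map_zeroMk, map_zeroMk, hιl.apply_apply_eq_zero, map_zero]
  let ψ := (map x ι 0).codRestrict (LinearMap.ker (map x l 0)) hzero
  refine ⟨e.symm ∘ₗ f, ε.symm ∘ₗ ψ ∘ₗ e, h ∘ₗ ε,
    e.symm.injective.comp hf, fun u => ?_, fun v => ?_, hh.comp ε.surjective⟩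
  · refine (ε.symm.map_eq_zero_iff.trans (Subtype.ext_iff.trans (hfι (e u)))).trans
      (exists_congr fun c => e.symm_apply_eq.symm)
  · refine (hhι (ε v)).trans (e.surjective.exists.trans (exists_congr fun u => ?_))
    exact (Subtype.ext_iff (a1 := ψ (e u)) (a2 := ε v)).symm.trans ε.symm_apply_eq.symm

end Splicing

end KoszulHomology

section Depth

open IsLocalRing RingTheory.Sequence
open scoped Pointwise

variable {A : Type*} [CommRing A] {d : ℕ} {x : Fin d → A}

theorem eq_zero_of_subsingleton_koszulHomology {M : Type*} [AddCommGroup M] [Module A M] {v : M}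
    (hv : ∀ j, x j • v = 0) (h : Subsingleton (KoszulHomology x M d)) : v = 0 := by
  have hchain : Pi.single Finset.univ v ∈ koszulChains A d M d := by
    simpa using single_mem_koszulChains (A := A) (Finset.univ : Finset (Fin d)) v
  have hcycle : koszulDifferential x M (Pi.single Finset.univ v) = 0 := by
    funext T
    refine Finset.sum_eq_zero fun i _ => ?_
    by_cases hT : insert i T = Finset.univ
    · rw [hT, Pi.single_eq_same, mul_smul, hv, smul_zero]
    · rw [Pi.single_eq_of_ne hT, smul_zero]
  obtain ⟨c, hc, hcv⟩ := (KoszulHomology.subsingleton_iff x).mp h _ hchain hcycle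
  rw [eq_zero_of_mem_koszulChains_of_lt d.lt_succ_self hc, map_zero] at hcv
  simpa using (congrFun hcv Finset.univ).symm

variable [IsLocalRing A]

theorem exists_mem_maximalIdeal_isSMulRegular [IsNoetherianRing A]
    (M : Type*) [AddCommGroup M] [Module A M] [Module.Finite A M]
    (hx : ∀ j, x j ∈ maximalIdeal A) (h : Subsingleton (KoszulHomology x M d)) :
    ∃ r ∈ maximalIdeal A, IsSMulRegular M r := by
  have hsub : Subsingleton ((A ⧸ maximalIdeal A) →ₗ[A] M) := by
    refine subsingleton_of_forall_eq 0 fun f => Submodule.linearMap_qext _ (LinearMap.ext_ring ?_)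
    refine eq_zero_of_subsingleton_koszulHomology (fun j => ?_) h
    rw [← map_smul, LinearMap.comp_apply, Submodule.mkQ_apply, smul_eq_mul, mul_one,
      (Submodule.Quotient.mk_eq_zero _).mpr (hx j), map_zero]
  simpa only [Ideal.annihilator_quotient] using IsSMulRegular.subsingleton_linearMap_iff.mp hsub

theorem exists_isRegular_of_subsingleton_koszulHomology [IsNoetherianRing A]
    (M : Type*) [AddCommGroup M] [Module A M] [Module.Finite A M] [Nontrivial M]
    (hx : ∀ j, x j ∈ maximalIdeal A) {k : ℕ}
    (h : ∀ i, d < i + k → Subsingleton (KoszulHomology x M i)) :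
    ∃ rs : List A, (∀ r ∈ rs, r ∈ maximalIdeal A) ∧ IsRegular M rs ∧ rs.length = k := by
  induction k generalizing M with
  | zero => exact ⟨[], by simp, IsRegular.nil A M, rfl⟩
  | succ k ih =>
    obtain ⟨r, hr, hreg⟩ := exists_mem_maximalIdeal_isSMulRegular M hx (h d (by omega))
    have := nontrivial_quotSMulTop_of_mem_maximalIdeal M hr
    obtain ⟨rs, hrs, hrr, hl⟩ := ih (QuotSMulTop r M) fun i hi => by
      cases i with
      | zero =>
        have := h 0 (by omega)
        exact (KoszulHomology.map_zero_surjective x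
          (f := (r • ⊤ : Submodule A M).mkQ) (Submodule.mkQ_surjective _)).subsingleton
      | succ i =>
        exact KoszulHomology.subsingleton_quotSMulTop_succ x hreg (h i (by omega))
          (h (i + 1) (by omega))
    exact ⟨r :: rs, List.forall_mem_cons.mpr ⟨hr, hrs⟩, IsRegular.cons hreg hrr, by simp [hl]⟩

theorem natCast_le_moduleDepth_iff_exists
    (M : Type*) [AddCommGroup M] [Module A M] [Nontrivial M] {k : ℕ} :
    (k : ℕ∞) ≤ moduleDepth A M ↔ ∃ rs : List A, (∀ r ∈ rs, r ∈ maximalIdeal A) ∧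
      IsRegular M rs ∧ k ≤ rs.length := by
  constructor
  · intro h
    rcases k with _ | k
    · exact ⟨[], by simp, IsRegular.nil A M, le_rfl⟩
    · obtain ⟨⟨rs, hrs, hreg⟩, hk⟩ :=
        lt_iSup_iff.mp (h.trans_lt' (Nat.cast_lt.mpr k.lt_succ_self))
      exact ⟨rs, hrs, hreg, Nat.cast_lt.mp hk⟩
  · rintro ⟨rs, hrs, hreg, hk⟩
    exact (Nat.cast_le.mpr hk).trans (le_iSup (fun rs : {rs : List A //
      (∀ r ∈ rs, r ∈ maximalIdeal A) ∧ IsRegular M rs} => (rs.1.length : ℕ∞)) ⟨rs, hrs, hreg⟩)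

variable [IsNoetherianRing A]

theorem natCast_le_moduleDepth_iff_subsingleton_koszulHomology
    (M : Type*) [AddCommGroup M] [Module A M] [Module.Finite A M] [Nontrivial M]
    (hx : ∀ j, x j ∈ maximalIdeal A)
    (hrad : maximalIdeal A ≤ (Ideal.span (Set.range x) ⊔ Module.annihilator A M).radical) (k : ℕ) :
    (k : ℕ∞) ≤ moduleDepth A M ↔ ∀ i, d < i + k → Subsingleton (KoszulHomology x M i) := by
  rw [natCast_le_moduleDepth_iff_exists]
  constructor
  · rintro ⟨rs, hrs, hreg, hk⟩ i hi
    exact KoszulHomology.subsingleton_of_isWeaklyRegular x (fun r hr => hrad (hrs r hr))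
      hreg.toIsWeaklyRegular (by omega)
  · intro h
    obtain ⟨rs, hrs, hreg, hk⟩ := exists_isRegular_of_subsingleton_koszulHomology M hx h
    exact ⟨rs, hrs, hreg, hk.ge⟩

omit [IsNoetherianRing A] in
theorem not_subsingleton_koszulHomology_zero
    (M : Type*) [AddCommGroup M] [Module A M] [Module.Finite A M] [Nontrivial M]
    (hx : ∀ j, x j ∈ maximalIdeal A) : ¬ Subsingleton (KoszulHomology x M 0) := by
  rw [← (KoszulHomology.zeroEquiv x M).subsingleton_congr, Submodule.Quotient.subsingleton_iff]
  refine (Submodule.top_ne_ideal_smul_of_le_jacobson_annihilator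
    (le_trans (Ideal.span_le.mpr ?_) (maximalIdeal_le_jacobson _))).symm
  exact Set.range_subset_iff.mpr hx

theorem moduleDepth_le (M : Type*) [AddCommGroup M] [Module A M] [Module.Finite A M] [Nontrivial M]
    (hx : ∀ j, x j ∈ maximalIdeal A)
    (hrad : maximalIdeal A ≤ (Ideal.span (Set.range x) ⊔ Module.annihilator A M).radical) :
    moduleDepth A M ≤ d := by
  refine ENat.forall_natCast_le_iff_le.mp fun k hk => ?_
  rw [Nat.cast_le]
  by_contra hkd
  exact not_subsingleton_koszulHomology_zero M hx
    ((natCast_le_moduleDepth_iff_subsingleton_koszulHomology M hx hrad k).mp hk 0 (by omega))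

theorem moduleDepth_eq_min_of_koszulHomology_shift
    (M N : Type*) [AddCommGroup M] [Module A M] [Module.Finite A M] [Nontrivial M]
    [AddCommGroup N] [Module A N] [Module.Finite A N] [Nontrivial N]
    (hx : ∀ j, x j ∈ maximalIdeal A)
    (hM : maximalIdeal A ≤ (Ideal.span (Set.range x) ⊔ Module.annihilator A M).radical)
    (hN : maximalIdeal A ≤ (Ideal.span (Set.range x) ⊔ Module.annihilator A N).radical)
    (h : ∀ i ≠ 0, Subsingleton (KoszulHomology x M (i + 2)) ↔
      Subsingleton (KoszulHomology x N i)) :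
    moduleDepth A N = min (d : ℕ∞) (moduleDepth A M + 2) := by
  refine ENat.eq_of_forall_natCast_le_iff fun k => ?_
  have hle : (k : ℕ∞) ≤ moduleDepth A N → k ≤ d := fun hk =>
    Nat.cast_le.mp (hk.trans (moduleDepth_le N hx hN))
  rw [le_min_iff, Nat.cast_le, ← and_iff_right_of_imp hle]
  refine and_congr_right fun hk => ?_
  have hcast : ((k - 2 : ℕ) : ℕ∞) = k - 2 := ENat.natCast_sub k 2
  rw [← tsub_le_iff_right, ← hcast,
    natCast_le_moduleDepth_iff_subsingleton_koszulHomology M hx hM,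
    natCast_le_moduleDepth_iff_subsingleton_koszulHomology N hx hN]
  constructor
  · intro hNk i hi
    by_cases hid : d < i
    · exact KoszulHomology.subsingleton_of_lt x M hid
    · obtain ⟨j, rfl⟩ : ∃ j, i = j + 2 := ⟨i - 2, by omega⟩
      exact (h j (by omega)).mpr (hNk j (by omega))
  · intro hMk i hi
    refine (h i (by omega)).mp ?_
    by_cases hid : d < i + 2
    · exact KoszulHomology.subsingleton_of_lt x M hid
    · exact hMk (i + 2) (by omega)

end Depth

section CohenMacaulay

open IsLocalRing RingTheory.Sequence
open scoped Pointwise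

variable {A : Type*} [CommRing A]

theorem maximalIdeal_mem_minimalPrimes_of_le_radical [IsLocalRing A] {I : Ideal A}
    (hI : I ≤ maximalIdeal A) (h : maximalIdeal A ≤ I.radical) :
    maximalIdeal A ∈ I.minimalPrimes :=
  ⟨⟨inferInstance, hI⟩, fun _ hq _ => h.trans (hq.1.radical_le_iff.mpr hq.2)⟩

theorem maximalIdeal_le_radical_of_ringKrullDim_quotient_eq_zero [IsLocalRing A] {I : Ideal A}
    (h : ringKrullDim (A ⧸ I) = 0) : maximalIdeal A ≤ I.radical := by
  have h0 : Ring.KrullDimLE 0 (A ⧸ I) := Ring.krullDimLE_iff.mpr h.le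
  rw [Ideal.radical_eq_sInf]
  refine le_sInf fun p ⟨hIp, hp⟩ => ?_
  have hmap := Ideal.map_isPrime_of_surjective (f := Ideal.Quotient.mk I) (I := p)
    Ideal.Quotient.mk_surjective (by rwa [Ideal.mk_ker])
  have hmax := Ring.krullDimLE_zero_iff.mp h0 _ hmap
  have hcomap := Ideal.comap_isMaximal_of_surjective (Ideal.Quotient.mk I)
    Ideal.Quotient.mk_surjective (K := p.map (Ideal.Quotient.mk I))
  rw [Ideal.comap_map_of_surjective' _ Ideal.Quotient.mk_surjective, Ideal.mk_ker,
    sup_eq_left.mpr hIp] at hcomap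
  exact (eq_maximalIdeal hcomap).ge

theorem isFiniteLength_of_maximalIdeal_le_radical_annihilator [IsLocalRing A] [IsNoetherianRing A]
    {M : Type*} [AddCommGroup M] [Module A M] [Module.Finite A M]
    (h : maximalIdeal A ≤ (Module.annihilator A M).radical) : IsFiniteLength A M := by
  cases subsingleton_or_nontrivial M
  · exact .of_subsingleton
  have hne : Module.annihilator A M ≠ ⊤ := Module.annihilator_eq_top_iff.not.mpr
    (not_subsingleton M)
  have : IsArtinianRing (A ⧸ Module.annihilator A M) :=
    quotient_artinian_of_mem_minimalPrimes_of_isLocalRing _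
      (maximalIdeal_mem_minimalPrimes_of_le_radical (le_maximalIdeal hne) h)
  let _ := Module.IsTorsionBySet.module (R := A) (M := M) (I := Module.annihilator A M)
    fun m a => Module.mem_annihilator.mp a.2 m
  have : IsScalarTower A (A ⧸ Module.annihilator A M) M := Module.IsTorsionBySet.isScalarTower _
  have : Module.Finite (A ⧸ Module.annihilator A M) M :=
    Module.Finite.of_restrictScalars_finite A _ M
  rw [← Module.length_ne_top_iff, Module.length_eq_of_surjective (S := A)
    (R := A ⧸ Module.annihilator A M) Ideal.Quotient.mk_surjective]
  exact Module.length_ne_top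

theorem ringKrullDim_le_length_of_maximalIdeal_le_radical [IsLocalRing A] [IsNoetherianRing A]
    {us : List A} (hus : ∀ u ∈ us, u ∈ maximalIdeal A)
    (h : maximalIdeal A ≤ (Ideal.ofList us).radical) : ringKrullDim A ≤ us.length := by
  classical
  have hspan : Ideal.span (us.toFinset : Set A) = Ideal.ofList us := by simp [Ideal.ofList]
  have hmin : maximalIdeal A ∈ (Ideal.span (us.toFinset : Set A)).minimalPrimes :=
    hspan ▸ maximalIdeal_mem_minimalPrimes_of_le_radical (Ideal.span_le.mpr hus) h
  have hht := Ideal.height_le_card_of_mem_minimalPrimes_span_finset hmin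
  rw [← maximalIdeal_height_eq_ringKrullDim]
  exact_mod_cast hht.trans (by exact_mod_cast us.toFinset_card_le)

theorem maximalIdeal_quotient_le_radical_map [IsLocalRing A] {I J : Ideal A}
    [IsLocalRing (A ⧸ I)] (h : maximalIdeal A ≤ (J ⊔ I).radical) :
    maximalIdeal (A ⧸ I) ≤ (J.map (Ideal.Quotient.mk I)).radical := by
  have := IsLocalHom.of_surjective _ (Ideal.Quotient.mk_surjective (I := I))
  intro b hb
  obtain ⟨a, rfl⟩ := Ideal.Quotient.mk_surjective b
  obtain ⟨k, hk⟩ := h ((map_mem_nonunits_iff (Ideal.Quotient.mk I) a).mp hb)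
  refine ⟨k, ?_⟩
  simpa only [Ideal.map_sup, Ideal.map_quotient_self, sup_bot_eq, map_pow] using
    Ideal.mem_map_of_mem (Ideal.Quotient.mk I) hk

theorem isLocalRing_quotient [IsLocalRing A] {I : Ideal A} (hI : I ≠ ⊤) : IsLocalRing (A ⧸ I) :=
  have := Ideal.Quotient.nontrivial_iff.mpr hI
  .of_surjective' (Ideal.Quotient.mk I) Ideal.Quotient.mk_surjective

theorem mk_mem_maximalIdeal_quotient [IsLocalRing A] {I : Ideal A} [IsLocalRing (A ⧸ I)] {a : A}
    (ha : a ∈ maximalIdeal A) : Ideal.Quotient.mk I a ∈ maximalIdeal (A ⧸ I) :=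
  have := IsLocalHom.of_surjective _ (Ideal.Quotient.mk_surjective (I := I))
  (map_mem_nonunits_iff (Ideal.Quotient.mk I) a).mpr ha

theorem ringKrullDim_quotient_le_length_of_maximalIdeal_le_radical [IsLocalRing A]
    [IsNoetherianRing A] {us : List A} (hus : ∀ u ∈ us, u ∈ maximalIdeal A) {I : Ideal A}
    (hI : I ≠ ⊤) (h : maximalIdeal A ≤ (Ideal.ofList us ⊔ I).radical) :
    ringKrullDim (A ⧸ I) ≤ us.length := by
  have := isLocalRing_quotient hI
  rw [← us.length_map (Ideal.Quotient.mk I)]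
  refine ringKrullDim_le_length_of_maximalIdeal_le_radical
    (List.forall_mem_map.mpr fun u hu => mk_mem_maximalIdeal_quotient (hus u hu)) ?_
  simpa only [Ideal.map_ofList] using maximalIdeal_quotient_le_radical_map h

theorem isSystemOfParameters_mk [IsLocalRing A] {d : ℕ} {x : Fin d → A} {I : Ideal A} (hI : I ≠ ⊤)
    (hx : ∀ i, x i ∈ maximalIdeal A) (hdim : ringKrullDim (A ⧸ I) = d)
    (hrad : maximalIdeal A ≤ (Ideal.span (Set.range x) ⊔ I).radical) :
    IsSystemOfParameters fun i => Ideal.Quotient.mk I (x i) := by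
  have := isLocalRing_quotient hI
  refine ⟨hdim, this, le_antisymm ?_ ?_⟩
  · rw [(maximalIdeal.isMaximal (A ⧸ I)).isPrime.radical_le_iff, Ideal.span_le]
    exact Set.range_subset_iff.mpr fun i => mk_mem_maximalIdeal_quotient (hx i)
  · have h := maximalIdeal_quotient_le_radical_map hrad
    rwa [Ideal.map_span, ← Set.range_comp] at h

theorem not_torsionBySet_le_smul_top [IsLocalRing A] {M : Type*} [AddCommGroup M] [Module A M]
    [IsNoetherian A M] {s : Set A} (hs : Submodule.torsionBySet A M s ≠ ⊥) {r : A}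
    (hr : r ∈ maximalIdeal A) (hreg : IsSMulRegular M r) :
    ¬ Submodule.torsionBySet A M s ≤ r • (⊤ : Submodule A M) := by
  intro hle
  refine hs (Submodule.eq_bot_of_le_smul_of_le_jacobson_bot (Ideal.span {r}) _
    (IsNoetherian.noetherian _) (fun n hn => ?_) ?_)
  · obtain ⟨v, -, rfl⟩ := Submodule.mem_smul_pointwise_iff_exists _ _ _ |>.mp (hle hn)
    refine Submodule.smul_mem_smul (Ideal.mem_span_singleton_self r)
      ((Submodule.mem_torsionBySet_iff _ _).mpr fun a => hreg ?_)
    simpa only [smul_comm r (a : A), smul_zero] using (Submodule.mem_torsionBySet_iff _ _).mp hn a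
  · rw [jacobson_eq_maximalIdeal ⊥ bot_ne_top]
    exact (Ideal.span_singleton_le_iff_mem _).mpr hr

theorem exists_associatedPrimes_quotSMulTop [IsLocalRing A] [IsNoetherianRing A]
    {M : Type*} [AddCommGroup M] [Module A M] [Module.Finite A M] {p : Ideal A}
    (hp : p ∈ associatedPrimes A M) {r : A} (hr : r ∈ maximalIdeal A) (hreg : IsSMulRegular M r) :
    ∃ q ∈ associatedPrimes A (QuotSMulTop r M), p ≤ q ∧ r ∈ q := by
  obtain ⟨hprime, m, hm⟩ := isAssociatedPrime_iff.mp hp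
  have htorsion : Submodule.torsionBySet A M p ≠ ⊥ := by
    refine (Submodule.ne_bot_iff _).mpr
      ⟨m, (Submodule.mem_torsionBySet_iff _ _).mpr fun a => ?_, ?_⟩
    · exact Submodule.mem_colon_singleton.mp (hm.le a.2)
    · rintro rfl
      exact hprime.ne_top (by rw [hm]; simp)
  obtain ⟨n, hn, hnr⟩ :=
    SetLike.not_le_iff_exists.mp (not_torsionBySet_le_smul_top htorsion hr hreg)
  obtain ⟨q, hq, hqn⟩ := exists_le_isAssociatedPrime_of_isNoetherianRing A
    (Submodule.Quotient.mk n : QuotSMulTop r M)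
    fun h => hnr ((Submodule.Quotient.mk_eq_zero _).mp h)
  refine ⟨q, hq, fun a ha => hqn ?_, hqn ?_⟩
  · rw [Submodule.mem_colon_singleton, ← Submodule.Quotient.mk_smul,
      (Submodule.mem_torsionBySet_iff _ _).mp hn ⟨a, ha⟩]
    exact zero_mem _
  · rw [Submodule.mem_colon_singleton, ← Submodule.Quotient.mk_smul, Submodule.mem_bot,
      Submodule.Quotient.mk_eq_zero]
    exact Submodule.smul_mem_pointwise_smul _ _ _ trivial

theorem ringKrullDim_quotient_add_one_le {p q : Ideal A} [p.IsPrime] (hpq : p ≤ q) {r : A}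
    (hrq : r ∈ q) (hrp : r ∉ p) : ringKrullDim (A ⧸ q) + 1 ≤ ringKrullDim (A ⧸ p) := by
  refine ringKrullDim_succ_le_of_surjective (Ideal.Quotient.factor hpq)
    (Ideal.Quotient.factor_surjective hpq) (r := Ideal.Quotient.mk p r) ?_ ?_
  · exact mem_nonZeroDivisors_of_ne_zero (Ideal.Quotient.eq_zero_iff_mem.not.mpr hrp)
  · rw [Ideal.Quotient.factor_mk]
    exact Ideal.Quotient.eq_zero_iff_mem.mpr hrq

theorem exists_mem_associatedPrimes_of_not_isSMulRegular [IsNoetherianRing A] {M : Type*}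
    [AddCommGroup M] [Module A M] {r : A} (h : ¬ IsSMulRegular M r) :
    ∃ p ∈ associatedPrimes A M, r ∈ p := by
  have hr : r ∈ ⋃ p ∈ associatedPrimes A M, (p : Set A) := by
    rw [biUnion_associatedPrimes_eq_compl_regular]
    exact h
  simpa only [Set.mem_iUnion, SetLike.mem_coe, exists_prop] using hr

theorem length_le_ringKrullDim_quotient_of_mem_associatedPrimes [IsLocalRing A]
    [IsNoetherianRing A] {M : Type*} [AddCommGroup M] [Module A M] [Module.Finite A M]
    {p : Ideal A} (hp : p ∈ associatedPrimes A M) {rs : List A}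
    (hrs : ∀ r ∈ rs, r ∈ maximalIdeal A) (h : IsWeaklyRegular M rs) :
    (rs.length : WithBot ℕ∞) ≤ ringKrullDim (A ⧸ p) := by
  have hprime : p.IsPrime := IsAssociatedPrime.isPrime hp
  induction rs generalizing M p with
  | nil => simpa using ringKrullDim_nonneg_of_nontrivial
  | cons r rs ih =>
    rw [isWeaklyRegular_cons_iff] at h
    obtain ⟨hr, hrs⟩ := List.forall_mem_cons.mp hrs
    obtain ⟨q, hq, hpq, hrq⟩ := exists_associatedPrimes_quotSMulTop hp hr h.1
    have hrp : r ∉ p := fun hrp => by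
      have hzero : r ∈ ⋃ p ∈ associatedPrimes A M, (p : Set A) := Set.mem_biUnion hp hrp
      rw [biUnion_associatedPrimes_eq_compl_regular] at hzero
      exact hzero h.1
    calc ((r :: rs).length : WithBot ℕ∞) = rs.length + 1 := by push_cast [List.length_cons]; rfl
      _ ≤ ringKrullDim (A ⧸ q) + 1 := by
        gcongr
        exact ih hq hrs h.2 (IsAssociatedPrime.isPrime hq)
      _ ≤ ringKrullDim (A ⧸ p) := ringKrullDim_quotient_add_one_le hpq hrq hrp

theorem isSMulRegular_of_length_lt_moduleDepth [IsLocalRing A] [IsNoetherianRing A] {M : Type*}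
    [AddCommGroup M] [Module A M] [Module.Finite A M] [Nontrivial M] {a : A} {us : List A}
    (hus : ∀ u ∈ us, u ∈ maximalIdeal A) (hd : ((a :: us).length : ℕ∞) ≤ moduleDepth A M)
    (hrad : maximalIdeal A ≤ (Ideal.ofList (a :: us) ⊔ Module.annihilator A M).radical) :
    IsSMulRegular M a := by
  by_contra hreg
  obtain ⟨p, hp, hap⟩ := exists_mem_associatedPrimes_of_not_isSMulRegular hreg
  obtain ⟨rs, hrs, hrsreg, hlen⟩ := (natCast_le_moduleDepth_iff_exists M).mp hd
  have hann : Module.annihilator A M ≤ p := by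
    simpa only [Submodule.annihilator_top] using IsAssociatedPrime.annihilator_le hp
  have hle : Ideal.ofList (a :: us) ⊔ Module.annihilator A M ≤ Ideal.ofList us ⊔ p := by
    rw [Ideal.ofList_cons, sup_le_iff, sup_le_iff, Ideal.span_singleton_le_iff_mem]
    exact ⟨⟨le_sup_right (a := Ideal.ofList us) hap, le_sup_left⟩, hann.trans le_sup_right⟩
  have hlength : (rs.length : WithBot ℕ∞) ≤ us.length :=
    (length_le_ringKrullDim_quotient_of_mem_associatedPrimes hp hrs hrsreg.toIsWeaklyRegular).trans
      (ringKrullDim_quotient_le_length_of_maximalIdeal_le_radical hus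
        (IsAssociatedPrime.isPrime hp).ne_top (hrad.trans (Ideal.radical_mono hle)))
  have : rs.length ≤ us.length := by exact_mod_cast hlength
  rw [List.length_cons] at hlen
  lia

theorem mem_maximalIdeal_of_isRegular [IsLocalRing A] {rs : List A} (h : IsRegular A rs) {r : A}
    (hr : r ∈ rs) : r ∈ maximalIdeal A := by
  have hne : Ideal.ofList rs ≠ ⊤ := fun htop => h.top_ne_smul (by rw [htop, Submodule.top_smul])
  exact le_maximalIdeal hne (Ideal.subset_span hr)

theorem ofList_eq_span_range_get (us : List A) :
    Ideal.ofList us = Ideal.span (Set.range us.get) :=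
  congrArg Ideal.span (Set.ext fun _ => List.mem_iff_get)

theorem length_le_moduleDepth_quotSMulTop [IsLocalRing A] [IsNoetherianRing A]
    {M : Type*} [AddCommGroup M] [Module A M] [Module.Finite A M] [Nontrivial M] {a : A}
    {us : List A} (hus : ∀ u ∈ a :: us, u ∈ maximalIdeal A) (ha : IsSMulRegular M a)
    (hd : ((a :: us).length : ℕ∞) ≤ moduleDepth A M)
    (hrad : maximalIdeal A ≤ (Ideal.ofList (a :: us) ⊔ Module.annihilator A M).radical) :
    (us.length : ℕ∞) ≤ moduleDepth A (QuotSMulTop a M) := by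
  have hx : ∀ j, (a :: us).get j ∈ maximalIdeal A := fun j => hus _ (List.get_mem _ _)
  have := nontrivial_quotSMulTop_of_mem_maximalIdeal M (hus a List.mem_cons_self)
  rw [ofList_eq_span_range_get] at hrad
  rw [natCast_le_moduleDepth_iff_subsingleton_koszulHomology M hx hrad] at hd
  rw [natCast_le_moduleDepth_iff_subsingleton_koszulHomology _ hx (hrad.trans (Ideal.radical_mono
    (sup_le_sup_left (LinearMap.annihilator_le_of_surjective (a • (⊤ : Submodule A M)).mkQ
      (Submodule.mkQ_surjective _)) _)))]
  intro i hi
  obtain ⟨p, rfl⟩ : ∃ p, i = p + 2 := ⟨i - 2, by rw [List.length_cons] at hi; lia⟩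
  exact KoszulHomology.subsingleton_quotSMulTop_succ _ ha (hd _ (by lia)) (hd _ (by lia))

theorem isRegular_of_length_le_moduleDepth [IsLocalRing A] [IsNoetherianRing A]
    {M : Type*} [AddCommGroup M] [Module A M] [Module.Finite A M] [Nontrivial M] {us : List A}
    (hus : ∀ u ∈ us, u ∈ maximalIdeal A) (hd : (us.length : ℕ∞) ≤ moduleDepth A M)
    (hrad : maximalIdeal A ≤ (Ideal.ofList us ⊔ Module.annihilator A M).radical) :
    IsRegular M us := by
  induction us generalizing M with
  | nil => exact IsRegular.nil A M
  | cons a us ih =>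
    have hus' := (List.forall_mem_cons.mp hus).2
    have ha := isSMulRegular_of_length_lt_moduleDepth hus' hd hrad
    have := nontrivial_quotSMulTop_of_mem_maximalIdeal M (hus a List.mem_cons_self)
    refine IsRegular.cons ha (ih hus' (length_le_moduleDepth_quotSMulTop hus ha hd hrad)
      (hrad.trans (Ideal.radical_mono ?_)))
    rw [Ideal.ofList_cons, sup_le_iff, sup_le_iff, Ideal.span_singleton_le_iff_mem]
    exact ⟨⟨le_sup_right (a := Ideal.ofList us) (QuotSMulTop.mem_annihilator M a), le_sup_left⟩,
      (LinearMap.annihilator_le_of_surjective (a • (⊤ : Submodule A M)).mkQ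
        (Submodule.mkQ_surjective _)).trans le_sup_right⟩

theorem length_le_height_of_isWeaklyRegular [IsNoetherianRing A] {I : Ideal A} {rs : List A}
    (hrs : ∀ r ∈ rs, r ∈ I) (h : IsWeaklyRegular A rs) : (rs.length : ℕ∞) ≤ I.height := by
  rw [Ideal.height_eq_inf_minimalPrimes]
  refine le_iInf₂ fun p hp => ?_
  have hprime : p.IsPrime := hp.1.1
  have hloc := h.isRegular_of_isLocalization_of_mem (Localization.AtPrime p) p
    fun r hr => hp.1.2 (hrs r hr)
  have : Nontrivial (Localization.AtPrime p ⧸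
      Ideal.ofList (rs.map (algebraMap A (Localization.AtPrime p)))) :=
    Ideal.Quotient.nontrivial_iff.mpr fun htop =>
      hloc.top_ne_smul (by rw [htop, Submodule.top_smul])
  have hdim := ringKrullDim_add_length_eq_ringKrullDim_of_isRegular _ hloc
  rw [IsLocalization.AtPrime.ringKrullDim_eq_height p (Localization.AtPrime p),
    List.length_map] at hdim
  have hle : ((rs.length : ℕ∞) : WithBot ℕ∞) ≤ p.height :=
    hdim ▸ le_add_of_nonneg_left ringKrullDim_nonneg_of_nontrivial
  exact_mod_cast hle

end CohenMacaulay

section Rees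

open CategoryTheory CategoryTheory.Abelian RingTheory.Sequence

variable {A : Type u} [CommRing A]

theorem nonempty_ext_quotSMulTop_equiv {M N : ModuleCat.{u} A} {r : A}
    (hr : r ∈ Module.annihilator A M) (hN : IsSMulRegular N r) {n : ℕ}
    (h : Subsingleton (Ext.{u} M N n)) :
    Nonempty (Ext.{u} M (ModuleCat.of A (QuotSMulTop r N)) n ≃ₗ[A] Ext.{u} M N (n + 1)) := by
  have hS := hN.smulShortComplex_shortExact
  refine ⟨LinearEquiv.ofBijective (Ext.postcompOfLinear hS.extClass A M rfl) ⟨?_, fun e => ?_⟩⟩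
  · rw [← LinearMap.ker_eq_bot, LinearMap.ker_eq_bot']
    intro e he
    obtain ⟨e', rfl⟩ := Ext.covariant_sequence_exact₃ M hS e rfl he
    have he' : e' = (0 : Ext M (N.smulShortComplex r).X₂ n) := h.elim _ _
    rw [he', Ext.zero_comp]
  · have h0 := Ext.postcomp_smul_id_eq_zero_of_mem_annihilator (M := N) hr (n + 1)
    exact Ext.covariant_sequence_exact₁ M hS e
      (DFunLike.congr_fun (congrArg AddCommGrpCat.Hom.hom h0) e) rfl

theorem subsingleton_ext_of_isRegular [IsNoetherianRing A] {M N : ModuleCat.{u} A}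
    [Module.Finite A M] [Module.Finite A N] {rs : List A}
    (hrs : ∀ r ∈ rs, r ∈ Module.annihilator A M) (hN : IsRegular N rs) {n : ℕ}
    (hn : n < rs.length) : Subsingleton (Ext.{u} M N n) := by
  refine ModuleCat.subsingleton_ext_of_exists_isRegular (Ideal.ofList rs) M ?_ N
    hN.top_ne_smul.symm.lt_top rs (fun r hr => Ideal.subset_span hr) hN n hn
  rw [Module.support_eq_zeroLocus]
  exact PrimeSpectrum.zeroLocus_anti_mono_ideal (Ideal.span_le.mpr hrs)

theorem nonempty_ext_equiv_of_isRegular [IsNoetherianRing A] {M N : ModuleCat.{u} A}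
    [Module.Finite A M] [Module.Finite A N] {rs : List A}
    (hrs : ∀ r ∈ rs, r ∈ Module.annihilator A M) (hN : IsRegular N rs) :
    Nonempty (Ext.{u} M N rs.length ≃ₗ[A]
      (M →ₗ[A] (N ⧸ (Ideal.ofList rs • ⊤ : Submodule A N)))) := by
  induction rs generalizing N with
  | nil =>
    refine ⟨Ext.linearEquiv₀.trans (ModuleCat.homLinearEquiv.trans
      (LinearEquiv.congrRight (Submodule.quotEquivOfEqBot _ ?_).symm))⟩
    rw [Ideal.ofList_nil, Submodule.bot_smul]
  | cons r rs ih =>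
    have h0 := subsingleton_ext_of_isRegular hrs hN (n := rs.length) (by simp)
    rw [isRegular_cons_iff] at hN
    obtain ⟨e⟩ := nonempty_ext_quotSMulTop_equiv (hrs r List.mem_cons_self) hN.1 h0
    obtain ⟨e'⟩ := ih (N := ModuleCat.of A (QuotSMulTop r N))
      (fun s hs => hrs s (List.mem_cons_of_mem r hs)) hN.2
    exact ⟨e.symm.trans (e'.trans (LinearEquiv.congrRight
      (Submodule.quotOfListConsSMulTopEquivQuotSMulTopInner N r rs).symm))⟩

end Rees

section Duality

open IsLocalRing

variable {A : Type*} [CommRing A]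

theorem length_linearMap_le_of_isFiniteLength [IsLocalRing A]
    {T : Type*} [AddCommGroup T] [Module A T]
    (hT : Module.length A ((A ⧸ maximalIdeal A) →ₗ[A] T) ≤ 1)
    {X : Type*} [AddCommGroup X] [Module A X] (hX : IsFiniteLength A X) :
    Module.length A (X →ₗ[A] T) ≤ Module.length A X := by
  induction hX with
  | of_subsingleton => exact Module.length_eq_zero.trans_le zero_le
  | @of_simple_quotient X _ _ N hs _ ih =>
    have hquot : Module.length A ((X ⧸ N) →ₗ[A] T) ≤ Module.length A (X ⧸ N) := by
      obtain ⟨m, hm, ⟨e⟩⟩ := isSimpleModule_iff_quot_maximal.mp hs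
      rw [eq_maximalIdeal hm] at e
      rwa [Module.length_eq_one A (X ⧸ N), (LinearEquiv.congrLeft T A e).length_eq]
    have hexact := LinearMap.exact_lcomp_of_exact_of_surjective T
      (LinearMap.exact_subtype_mkQ N) N.mkQ_surjective
    calc Module.length A (X →ₗ[A] T)
        = Module.length A ((X ⧸ N) →ₗ[A] T) +
            Module.length A (LinearMap.range (LinearMap.lcomp A T N.subtype)) :=
          Module.length_eq_add_of_exact (LinearMap.lcomp A T N.mkQ)
            (LinearMap.lcomp A T N.subtype).rangeRestrict
            (LinearMap.lcomp_injective_of_surjective _ N.mkQ_surjective)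
            (LinearMap.surjective_rangeRestrict _)
            fun f => Subtype.ext_iff.trans (hexact f)
      _ ≤ Module.length A (X ⧸ N) + Module.length A N :=
          add_le_add hquot
            ((Module.length_le_of_injective _ (Submodule.injective_subtype _)).trans ih)
      _ = Module.length A X := by
          rw [add_comm, Module.length_eq_add_of_exact N.subtype N.mkQ N.injective_subtype
            N.mkQ_surjective (LinearMap.exact_subtype_mkQ N)]

theorem mem_range_eval_one_iff {I : Ideal A} (K : Submodule A (A ⧸ I)) {v : A ⧸ I} :
    v ∈ LinearMap.range
        (LinearMap.applyₗ (R := A) (M₂ := A ⧸ I) (K.mkQ 1)) ↔ ∀ t ∈ K, v * t = 0 := by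
  constructor
  · rintro ⟨f, rfl⟩ t ht
    obtain ⟨a, rfl⟩ := Ideal.Quotient.mk_surjective t
    have hmk : Ideal.Quotient.mk I a = a • (1 : A ⧸ I) := by
      rw [Algebra.smul_def, mul_one, Ideal.Quotient.algebraMap_eq]
    rw [hmk] at ht ⊢
    rw [mul_smul_comm, mul_one, LinearMap.applyₗ_apply_apply, ← map_smul, ← map_smul,
      Submodule.mkQ_apply, (Submodule.Quotient.mk_eq_zero K).mpr ht, map_zero]
  · intro hv
    exact ⟨K.liftQ (LinearMap.mulLeft A v) hv, mul_one v⟩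

/- Double annihilators over `T = A ⧸ I`: with `K` the annihilator of `c`, the annihilator of `K`
contains `c T ≅ T ⧸ K` and is a quotient of `Hom(T ⧸ K, T)`, which is not longer than `T ⧸ K`. -/
theorem exists_smul_eq_of_forall_smul_eq_zero [IsLocalRing A] {I : Ideal A}
    (hI : IsFiniteLength A (A ⧸ I))
    (hT : Module.length A ((A ⧸ maximalIdeal A) →ₗ[A] (A ⧸ I)) ≤ 1) {c : A} {v : A ⧸ I}
    (h : ∀ t : A ⧸ I, c • t = 0 → v * t = 0) : ∃ t : A ⧸ I, c • t = v := by
  obtain ⟨_, _⟩ := isFiniteLength_iff_isNoetherian_isArtinian.mp hI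
  set φ := LinearMap.lsmul A (A ⧸ I) c
  set J := LinearMap.range (LinearMap.applyₗ (R := A) (M₂ := A ⧸ I) ((LinearMap.ker φ).mkQ 1))
  have hφJ : LinearMap.range φ ≤ J := by
    rintro _ ⟨s, rfl⟩
    refine (mem_range_eval_one_iff _).mpr fun t ht => ?_
    rw [LinearMap.lsmul_apply, smul_mul_assoc, ← mul_smul_comm, show c • t = 0 from ht, mul_zero]
  have hlength : Module.length A J ≤ Module.length A (LinearMap.range φ) :=
    calc Module.length A J
        ≤ Module.length A (((A ⧸ I) ⧸ LinearMap.ker φ) →ₗ[A] (A ⧸ I)) :=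
          Module.length_le_of_surjective _ (LinearMap.surjective_rangeRestrict _)
      _ ≤ Module.length A ((A ⧸ I) ⧸ LinearMap.ker φ) :=
          length_linearMap_le_of_isFiniteLength hT (hI.of_surjective (Submodule.mkQ_surjective _))
      _ = Module.length A (LinearMap.range φ) := φ.quotKerEquivRange.length_eq
  have heq : LinearMap.range φ = J := hφJ.eq_of_not_lt fun hlt =>
    (Submodule.height_strictMono hlt).not_ge (by simpa only [Module.length_submodule] using hlength)
  exact heq.ge ((mem_range_eval_one_iff _).mpr h)

theorem mem_span_singleton_sup_of_forall_mul_mem [IsLocalRing A] {I : Ideal A}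
    (hI : IsFiniteLength A (A ⧸ I))
    (hT : Module.length A ((A ⧸ maximalIdeal A) →ₗ[A] (A ⧸ I)) ≤ 1) {c v : A}
    (h : ∀ a, c * a ∈ I → v * a ∈ I) : v ∈ Ideal.span {c} ⊔ I := by
  obtain ⟨t, ht⟩ := exists_smul_eq_of_forall_smul_eq_zero hI hT (c := c)
    (v := Ideal.Quotient.mk I v) fun t => by
      obtain ⟨a, rfl⟩ := Ideal.Quotient.mk_surjective t
      rw [Algebra.smul_def, Ideal.Quotient.algebraMap_eq, ← map_mul, ← map_mul,
        Ideal.Quotient.eq_zero_iff_mem, Ideal.Quotient.eq_zero_iff_mem]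
      exact h a
  obtain ⟨b, rfl⟩ := Ideal.Quotient.mk_surjective t
  rw [← Ideal.mem_quotient_iff_mem_sup, ← ht, Algebra.smul_def]
  exact Ideal.mul_mem_right _ _ (Ideal.mem_map_of_mem _ (Ideal.mem_span_singleton_self c))

end Duality

section Socle

open IsLocalRing RingTheory.Sequence CategoryTheory.Abelian

variable {A : Type u} [CommRing A]

theorem nonempty_ext_residueField_equiv [IsLocalRing A] [IsNoetherianRing A] {zs : List A}
    (hzs : IsRegular A zs) :
    Nonempty (Ext.{u} (ModuleCat.of A (A ⧸ maximalIdeal A)) (ModuleCat.of A A) zs.length ≃ₗ[A]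
      ((A ⧸ maximalIdeal A) →ₗ[A] (A ⧸ Ideal.ofList zs))) := by
  obtain ⟨e⟩ := nonempty_ext_equiv_of_isRegular (M := ModuleCat.of A (A ⧸ maximalIdeal A))
    (N := ModuleCat.of A A) (rs := zs)
    (fun z hz => by rw [Ideal.annihilator_quotient]; exact mem_maximalIdeal_of_isRegular hzs hz) hzs
  exact ⟨e.trans (LinearEquiv.congrRight (Submodule.quotEquivOfEq _ _
    (by rw [smul_eq_mul, Ideal.mul_top])))⟩

theorem exists_ofList_eq_maximalIdeal [IsRegularLocalRing A] {n : ℕ} (hn : ringKrullDim A = n) :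
    ∃ us : List A, us.length = n ∧ Ideal.ofList us = maximalIdeal A := by
  have hfg := (maximalIdeal A).fg_of_isNoetherianRing
  have hfin := Submodule.FG.finite_generators hfg
  refine ⟨hfin.toFinset.toList, ?_, ?_⟩
  · have hrank := IsRegularLocalRing.spanFinrank_maximalIdeal (R := A)
    rw [hn] at hrank
    rw [Finset.length_toList, ← Set.ncard_eq_toFinset_card _ hfin,
      Submodule.FG.generators_ncard hfg]
    exact_mod_cast hrank
  · simp only [Ideal.ofList, Finset.mem_toList, Set.Finite.mem_toFinset, Set.ofPred_mem_eq]
    exact (maximalIdeal A).span_generators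

theorem length_end_residueField_le_one [IsLocalRing A] :
    Module.length A ((A ⧸ maximalIdeal A) →ₗ[A] (A ⧸ maximalIdeal A)) ≤ 1 := by
  have : IsSimpleModule A (A ⧸ maximalIdeal A) :=
    isSimpleModule_iff_quot_maximal.mpr ⟨_, inferInstance, ⟨LinearEquiv.refl _ _⟩⟩
  rw [← Module.length_eq_one A (A ⧸ maximalIdeal A)]
  refine Module.length_le_of_injective
    (LinearMap.applyₗ (R := A) (M₂ := A ⧸ maximalIdeal A) (1 : A ⧸ maximalIdeal A))
    fun f g hfg => Submodule.linearMap_qext _ (LinearMap.ext_ring hfg)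

theorem length_ext_residueField_le_one [IsRegularLocalRing A] {zs : List A}
    (hzs : IsRegular A zs) (hdim : ringKrullDim A = zs.length) :
    Module.length A
      (Ext.{u} (ModuleCat.of A (A ⧸ maximalIdeal A)) (ModuleCat.of A A) zs.length) ≤ 1 := by
  obtain ⟨us, hlength, hspan⟩ := exists_ofList_eq_maximalIdeal hdim
  have hus : ∀ u ∈ us, u ∈ maximalIdeal A := fun u hu => hspan ▸ Ideal.subset_span hu
  have hdepth : (us.length : ℕ∞) ≤ moduleDepth A A :=
    (natCast_le_moduleDepth_iff_exists A).mpr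
      ⟨zs, fun _ => mem_maximalIdeal_of_isRegular hzs, hzs, hlength.le⟩
  have hreg : IsRegular A us := isRegular_of_length_le_moduleDepth hus hdepth
    (hspan ▸ le_sup_left.trans Ideal.le_radical)
  obtain ⟨e⟩ := nonempty_ext_residueField_equiv hreg
  rw [← hlength, e.length_eq, hspan]
  exact length_end_residueField_le_one

end Socle

section MonomialConjecture

open IsLocalRing RingTheory.Sequence

variable {A : Type*} [CommRing A] {d : ℕ} {x : Fin d → A}

theorem mk_mem_smul_top_iff {I J : Ideal A} {a : A} :
    Ideal.Quotient.mk J a ∈ (I • ⊤ : Submodule A (A ⧸ J)) ↔ a ∈ I ⊔ J := by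
  rw [Ideal.smul_top_eq_map]
  exact Ideal.mem_quotient_iff_mem_sup

/- The lemma of Artin and Rees, applied to the submodule `φ M` of `N`. -/
theorem exists_forall_mem_smul_top_of_ker_le [IsNoetherianRing A] {M N : Type*} [AddCommGroup M]
    [Module A M] [AddCommGroup N] [Module A N] [Module.Finite A N] {φ : M →ₗ[A] N} {I : Ideal A}
    (h : LinearMap.ker φ ≤ I • ⊤) :
    ∃ n : ℕ, ∀ t, n ≤ t → ∀ m, φ m ∈ (I ^ t • ⊤ : Submodule A N) → m ∈ (I • ⊤ : Submodule A M) := by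
  obtain ⟨k, hk⟩ := I.exists_pow_inf_eq_pow_smul (LinearMap.range φ)
  refine ⟨k + 1, fun t ht m hm => ?_⟩
  have hle : I ^ (t - k) • (I ^ k • ⊤ ⊓ LinearMap.range φ) ≤ (I • ⊤ : Submodule A M).map φ := by
    rw [Submodule.map_smul'', Submodule.map_top]
    exact Submodule.smul_mono (Ideal.pow_le_self (by lia)) inf_le_right
  have hmem : φ m ∈ I ^ t • ⊤ ⊓ LinearMap.range φ := ⟨hm, m, rfl⟩
  rw [hk t (by lia)] at hmem
  obtain ⟨m', hm', heq⟩ := hle hmem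
  rw [← sub_add_cancel m m']
  exact add_mem (h (by rw [LinearMap.mem_ker, map_sub, heq, sub_self])) hm'

theorem prod_pow_mul_mem_span_pow_sup {J : Ideal A} {t : ℕ} {a : A}
    (ha : a ∈ Ideal.span (Set.range x) ⊔ J) :
    (∏ i, x i ^ t) * a ∈ Ideal.span (Set.range fun i => x i ^ (t + 1)) ⊔ J := by
  set I := Ideal.span (Set.range fun i => x i ^ (t + 1)) ⊔ J
  suffices h : Ideal.span (Set.range x) ⊔ J ≤
      Submodule.comap (LinearMap.mulLeft A (∏ i, x i ^ t)) I from h ha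
  refine sup_le (Ideal.span_le.mpr (Set.range_subset_iff.mpr fun i => ?_)) fun b hb =>
    Ideal.mul_mem_left _ _ (Ideal.mem_sup_right hb)
  change (∏ i, x i ^ t) * x i ∈ I
  rw [← Finset.mul_prod_erase _ _ (Finset.mem_univ i), mul_right_comm, ← pow_succ]
  exact Ideal.mul_mem_right _ _ (Ideal.mem_sup_left (Ideal.subset_span ⟨i, rfl⟩))

theorem mem_span_singleton_sup_of_pow_mul_mem {I : Ideal A} {u w : A}
    (hu : IsSMulRegular (A ⧸ I) u) {t : ℕ} (h : u ^ t * w ∈ Ideal.span {u ^ (t + 1)} ⊔ I) :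
    w ∈ Ideal.span {u} ⊔ I := by
  obtain ⟨c, b, hb, heq⟩ := Ideal.mem_span_singleton_sup.mp h
  have hmem : u ^ t • (w - c * u) ∈ I := by
    convert hb using 1
    rw [smul_eq_mul]
    linear_combination -heq
  refine Ideal.mem_span_singleton_sup.mpr ⟨c, w - c * u, ?_, add_sub_cancel _ _⟩
  exact mem_of_isSMulRegular_quotient_of_smul_mem (hu.pow t) hmem

theorem satisfiesMonomialConjecture_mk_iff {I : Ideal A} :
    SatisfiesMonomialConjecture (fun i => Ideal.Quotient.mk I (x i)) ↔
      ∀ t : ℕ, 1 ≤ t → ∏ i, x i ^ t ∉ Ideal.span (Set.range fun i => x i ^ (t + 1)) ⊔ I := by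
  refine forall_congr' fun t => imp_congr_right fun _ => not_congr ?_
  rw [← Ideal.mem_quotient_iff_mem_sup, Ideal.map_span, ← Set.range_comp]
  simp only [Function.comp_def, map_prod, map_pow]

theorem span_range_eq_span_singleton_sup {ι : Type*} (z : ι → A) (k : ι) :
    Ideal.span (Set.range z) = Ideal.span {z k} ⊔ Ideal.span (z '' {k}ᶜ) := by
  rw [← Set.insert_image_compl_eq_range z k, Ideal.span_insert]

theorem ofList_ofFn (z : Fin d → A) : Ideal.ofList (List.ofFn z) = Ideal.span (Set.range z) :=
  congrArg Ideal.span (Set.ext (List.mem_ofFn' z))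

/-- The sequence `x₁, …, x_d` followed by `ys` is `A`-regular and has `dim A` elements. It is split
in two because `x` and `ys` play different roles below: the `ys` are divided out. -/
structure IsMaximalRegularSequence [IsLocalRing A] (x : Fin d → A) (ys : List A) : Prop where
  isRegular : IsRegular A (List.ofFn x ++ ys)
  ringKrullDim_eq : ringKrullDim A = (d + ys.length : ℕ)

namespace IsMaximalRegularSequence

variable [IsLocalRing A] {ys : List A}

theorem mem_maximalIdeal (h : IsMaximalRegularSequence x ys) (i : Fin d) :
    x i ∈ maximalIdeal A :=
  mem_maximalIdeal_of_isRegular h.isRegular (List.mem_append_left _ (by simp [List.mem_ofFn]))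

variable [IsNoetherianRing A]

theorem ringKrullDim_quotient_eq_zero (h : IsMaximalRegularSequence x ys) :
    ringKrullDim (A ⧸ (Ideal.span (Set.range x) ⊔ Ideal.ofList ys)) = 0 := by
  have hdim := ringKrullDim_add_length_eq_ringKrullDim_of_isRegular _ h.isRegular
  rw [h.ringKrullDim_eq, List.length_append, List.length_ofFn, Ideal.ofList_append,
    ofList_ofFn] at hdim
  exact ENat.WithBot.add_natCast_cancel.mp (hdim.trans (zero_add _).symm)

theorem maximalIdeal_le_radical (h : IsMaximalRegularSequence x ys) :
    maximalIdeal A ≤ (Ideal.span (Set.range x) ⊔ Ideal.ofList ys).radical :=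
  maximalIdeal_le_radical_of_ringKrullDim_quotient_eq_zero h.ringKrullDim_quotient_eq_zero

theorem isFiniteLength_quotient (h : IsMaximalRegularSequence x ys) :
    IsFiniteLength A (A ⧸ (Ideal.span (Set.range x) ⊔ Ideal.ofList ys)) :=
  isFiniteLength_of_maximalIdeal_le_radical_annihilator
    (by rw [Ideal.annihilator_quotient]; exact h.maximalIdeal_le_radical)

theorem pow (h : IsMaximalRegularSequence x ys) {e : Fin d → ℕ} (he : ∀ i, e i ≠ 0) :
    IsMaximalRegularSequence (fun i => x i ^ e i) ys := by
  have hmem := fun r => mem_maximalIdeal_of_isRegular h.isRegular (r := r)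
  have hmem' : ∀ r ∈ List.ofFn (fun i => x i ^ e i) ++ ys, r ∈ maximalIdeal A := by
    simp only [List.forall_mem_append, List.forall_mem_ofFn_iff]
    exact ⟨fun i => Ideal.pow_mem_of_mem _ (h.mem_maximalIdeal i) _ (Nat.pos_of_ne_zero (he i)),
      fun r hr => hmem r (List.mem_append_right _ hr)⟩
  refine ⟨isRegular_of_length_le_moduleDepth hmem'
    ((natCast_le_moduleDepth_iff_exists A).mpr ⟨_, hmem, h.isRegular, by simp⟩) ?_,
    h.ringKrullDim_eq⟩
  refine le_trans ?_ (Ideal.radical_mono le_sup_left)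
  rw [Ideal.ofList_append, ofList_ofFn]
  refine h.maximalIdeal_le_radical.trans (Ideal.radical_le_radical_iff.mpr (sup_le ?_
    (le_sup_right.trans Ideal.le_radical)))
  exact Ideal.span_le.mpr (Set.range_subset_iff.mpr fun i =>
    ⟨e i, Ideal.mem_sup_left (Ideal.subset_span ⟨i, rfl⟩)⟩)

theorem isSMulRegular_quotient (h : IsMaximalRegularSequence x ys) (k : Fin d) :
    IsSMulRegular (A ⧸ (Ideal.span (x '' {k}ᶜ) ⊔ Ideal.ofList ys)) (x k) := by
  set zs := ((List.finRange d).erase k).map x ++ ys with hzs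
  have hspan : (Ideal.ofList zs • ⊤ : Ideal A) = Ideal.span (x '' {k}ᶜ) ⊔ Ideal.ofList ys := by
    rw [smul_eq_mul, Ideal.mul_top, hzs, Ideal.ofList_append]
    congr 1
    refine congrArg Ideal.span (Set.ext fun a => ?_)
    simp [(List.nodup_finRange d).mem_erase_iff]
  have hperm : List.Perm (List.ofFn x ++ ys) (zs ++ [x k]) := by
    rw [List.ofFn_eq_map]
    exact (((List.perm_cons_erase (List.mem_finRange k)).map x).append_right ys).trans
      (List.perm_append_singleton _ _).symm
  have hreg := (IsLocalRing.isRegular_of_perm h.isRegular hperm).toIsWeaklyRegular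
  rw [isWeaklyRegular_append_iff, isWeaklyRegular_singleton_iff] at hreg
  exact ((Submodule.quotEquivOfEq _ _ hspan).isSMulRegular_congr _).mp hreg.2

theorem isWeaklyRegular_quotient (h : IsMaximalRegularSequence x ys) :
    IsWeaklyRegular (A ⧸ Ideal.ofList ys) (List.ofFn x) := by
  have hreg := (IsLocalRing.isRegular_of_perm h.isRegular List.perm_append_comm).toIsWeaklyRegular
  rw [isWeaklyRegular_append_iff] at hreg
  exact ((Submodule.quotEquivOfEq _ _ (by rw [smul_eq_mul, Ideal.mul_top])).isWeaklyRegular_congr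
    _).mp hreg.2

theorem isRegular_ys (h : IsMaximalRegularSequence x ys) : IsRegular A ys := by
  have hperm := IsLocalRing.isRegular_of_perm h.isRegular List.perm_append_comm
  refine (IsLocalRing.isRegular_iff_isWeaklyRegular_of_subset_maximalIdeal fun r hr =>
    mem_maximalIdeal_of_isRegular hperm (List.mem_append_left _ hr)).mpr ?_
  exact ((isWeaklyRegular_append_iff _ _ _).mp hperm.toIsWeaklyRegular).1

theorem subsingleton_koszulHomology (h : IsMaximalRegularSequence x ys) {p : ℕ}
    (hp : p ≠ 0) : Subsingleton (KoszulHomology x (A ⧸ Ideal.ofList ys) p) :=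
  KoszulHomology.subsingleton_of_isWeaklyRegular_ofFn x h.isWeaklyRegular_quotient hp

theorem mem_of_prod_pow_mul_mem (h : IsMaximalRegularSequence x ys) (t : ℕ) {F : Finset (Fin d)}
    {a : A} (ha : (∏ i ∈ F, x i ^ t) * a ∈
      Ideal.span (Set.range fun i => x i ^ if i ∈ F then t + 1 else 1) ⊔ Ideal.ofList ys) :
    a ∈ Ideal.span (Set.range x) ⊔ Ideal.ofList ys := by
  induction F using Finset.induction_on with
  | empty => simpa using ha
  | insert k F hk ih =>
    refine ih ?_
    set z : Fin d → A := fun i => x i ^ if i ∈ F then t + 1 else 1 with hz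
    set z' : Fin d → A := fun i => x i ^ if i ∈ insert k F then t + 1 else 1 with hz'
    have hzk : z k = x k := by simp [hz, hk]
    have hzk' : z' k = x k ^ (t + 1) := by simp [hz']
    have himage : z' '' {k}ᶜ = z '' {k}ᶜ :=
      Set.image_congr fun i (hi : i ≠ k) => by simp [hz, hz', hi]
    have hregular := (h.pow (e := fun i => if i ∈ F then t + 1 else 1)
      fun i => by split_ifs <;> simp).isSMulRegular_quotient k
    rw [span_range_eq_span_singleton_sup z' k, hzk', himage, sup_assoc, Finset.prod_insert hk,
      mul_assoc] at ha
    rw [span_range_eq_span_singleton_sup z k, hzk, sup_assoc]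
    exact mem_span_singleton_sup_of_pow_mul_mem (hzk ▸ hregular) ha

theorem ker_lsmul_le_of_not_satisfiesMonomialConjecture (h : IsMaximalRegularSequence x ys) {l : A}
    (hmc : ¬ SatisfiesMonomialConjecture
      fun i => Ideal.Quotient.mk (Ideal.ofList (l :: ys)) (x i)) :
    LinearMap.ker (LinearMap.lsmul A (A ⧸ Ideal.ofList ys) l) ≤ Ideal.span (Set.range x) • ⊤ := by
  simp only [satisfiesMonomialConjecture_mk_iff, Ideal.ofList_cons, not_forall, not_not] at hmc
  obtain ⟨t, -, ht⟩ := hmc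
  rw [sup_left_comm, Ideal.mem_span_singleton_sup] at ht
  obtain ⟨c, q, hq, heq⟩ := ht
  intro v hv
  obtain ⟨a, rfl⟩ := Ideal.Quotient.mk_surjective v
  have hla : l * a ∈ Ideal.ofList ys := Ideal.Quotient.eq_zero_iff_mem.mp hv
  refine mk_mem_smul_top_iff.mpr (h.mem_of_prod_pow_mul_mem t (F := Finset.univ) ?_)
  simp only [Finset.mem_univ, if_true]
  rw [← heq, add_mul, mul_assoc]
  exact add_mem (Ideal.mul_mem_left _ _ (Ideal.mem_sup_right hla)) (Ideal.mul_mem_right _ _ hq)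

end IsMaximalRegularSequence

end MonomialConjecture

section GorensteinMonomialConjecture

open IsLocalRing RingTheory.Sequence CategoryTheory.Abelian

variable {A : Type u} [CommRing A] [IsLocalRing A] [IsNoetherianRing A] {d : ℕ} {x : Fin d → A}
  {ys : List A}

namespace IsMaximalRegularSequence

theorem length_socle_le_one (h : IsMaximalRegularSequence x ys)
    (hA : Module.length A (Ext.{u} (ModuleCat.of A (A ⧸ maximalIdeal A)) (ModuleCat.of A A)
      (d + ys.length)) ≤ 1) :
    Module.length A
      ((A ⧸ maximalIdeal A) →ₗ[A] (A ⧸ (Ideal.span (Set.range x) ⊔ Ideal.ofList ys))) ≤ 1 := by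
  obtain ⟨e⟩ := nonempty_ext_residueField_equiv h.isRegular
  rwa [← ofList_ofFn, ← Ideal.ofList_append, ← e.length_eq, List.length_append, List.length_ofFn]

/- If `l` kills only elements of `(x) A/(ys)`, then by Artin-Rees the annihilator of `l` in
`A/(xᵗ⁺¹, ys)` is killed by `∏ xᵢᵗ` for large `t`; as this ring is Gorenstein of dimension zero,
`∏ xᵢᵗ` is then a multiple of `l` in it. -/
theorem not_satisfiesMonomialConjecture_of_ker_lsmul_le (h : IsMaximalRegularSequence x ys)
    (hA : Module.length A (Ext.{u} (ModuleCat.of A (A ⧸ maximalIdeal A)) (ModuleCat.of A A)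
      (d + ys.length)) ≤ 1) {l : A}
    (hker : LinearMap.ker (LinearMap.lsmul A (A ⧸ Ideal.ofList ys) l) ≤
      Ideal.span (Set.range x) • ⊤) :
    ¬ SatisfiesMonomialConjecture
      fun i => Ideal.Quotient.mk (Ideal.ofList (l :: ys)) (x i) := by
  simp only [satisfiesMonomialConjecture_mk_iff, Ideal.ofList_cons, not_forall, not_not]
  obtain ⟨n, hn⟩ := exists_forall_mem_smul_top_of_ker_le hker
  have hpow := h.pow (e := fun _ => n + 1 + 1) fun _ => Nat.succ_ne_zero _
  refine ⟨n + 1, n.succ_pos, ?_⟩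
  rw [sup_left_comm]
  refine mem_span_singleton_sup_of_forall_mul_mem hpow.isFiniteLength_quotient
    (hpow.length_socle_le_one hA) fun a ha => prod_pow_mul_mem_span_pow_sup ?_
  have hle : Ideal.span (Set.range fun i => x i ^ (n + 1 + 1)) ≤
      Ideal.span (Set.range x) ^ (n + 1 + 1) :=
    Ideal.span_le.mpr (Set.range_subset_iff.mpr fun i =>
      Ideal.pow_mem_pow (Ideal.subset_span (Set.mem_range_self i)) _)
  exact mk_mem_smul_top_iff.mp
    (hn (n + 1 + 1) (by lia) _ (mk_mem_smul_top_iff.mpr (sup_le_sup_right hle _ ha)))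

theorem satisfiesMonomialConjecture_iff (h : IsMaximalRegularSequence x ys)
    (hA : Module.length A (Ext.{u} (ModuleCat.of A (A ⧸ maximalIdeal A)) (ModuleCat.of A A)
      (d + ys.length)) ≤ 1) (l : A) :
    SatisfiesMonomialConjecture
        (fun i => Ideal.Quotient.mk (Ideal.ofList (l :: ys)) (x i)) ↔
      ¬ LinearMap.ker (LinearMap.lsmul A (A ⧸ Ideal.ofList ys) l) ≤
        Ideal.span (Set.range x) • ⊤ :=
  ⟨fun hmc hker => h.not_satisfiesMonomialConjecture_of_ker_lsmul_le hA hker hmc,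
    fun hker => not_not.mp (mt h.ker_lsmul_le_of_not_satisfiesMonomialConjecture hker)⟩

end IsMaximalRegularSequence

end GorensteinMonomialConjecture

section CanonicalModuleAsKernel

open IsLocalRing RingTheory.Sequence

variable {A : Type u} [CommRing A]

theorem nonempty_linearMap_quotient_equiv_ker {M : Type*} [AddCommGroup M] [Module A M]
    {I : Ideal A} (hI : I ≤ Module.annihilator A M) (l : A) :
    Nonempty (((A ⧸ (Ideal.span {l} ⊔ I)) →ₗ[A] M) ≃ₗ[A]
      LinearMap.ker (LinearMap.lsmul A M l)) := by
  have hone : l • (1 : A ⧸ (Ideal.span {l} ⊔ I)) = 0 := by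
    rw [Algebra.smul_def, mul_one]
    exact Ideal.Quotient.eq_zero_iff_mem.mpr
      (Ideal.mem_sup_left (Ideal.mem_span_singleton_self l))
  let φ : ((A ⧸ (Ideal.span {l} ⊔ I)) →ₗ[A] M) →ₗ[A] LinearMap.ker (LinearMap.lsmul A M l) :=
    (LinearMap.applyₗ (R := A) (1 : A ⧸ (Ideal.span {l} ⊔ I))).codRestrict _ fun f =>
      (map_smul f l 1).symm.trans (by rw [hone, map_zero])
  refine ⟨.ofBijective φ ⟨fun f g hfg => ?_, fun ⟨m, hm⟩ => ?_⟩⟩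
  · exact Submodule.linearMap_qext _ (LinearMap.ext_ring (congrArg Subtype.val hfg))
  · have hle : Ideal.span {l} ⊔ I ≤ LinearMap.ker (LinearMap.toSpanSingleton A M m) :=
      sup_le ((Ideal.span_singleton_le_iff_mem _).mpr hm)
        fun a ha => Module.mem_annihilator.mp (hI ha) m
    exact ⟨Submodule.liftQ _ (LinearMap.toSpanSingleton A M m) hle, Subtype.ext (one_smul A m)⟩

theorem nonempty_canonicalModule_equiv_ker [IsNoetherianRing A] {I : Ideal A} {l : A} {zs : List A}
    (hI : I = Ideal.ofList (l :: zs)) (hzs : IsRegular A zs)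
    (hcodim : quotientCodim I = zs.length) :
    Nonempty (CanonicalModule I ≃ₗ[A]
      LinearMap.ker (LinearMap.lsmul A (A ⧸ Ideal.ofList zs) l)) := by
  obtain ⟨e⟩ := nonempty_ext_equiv_of_isRegular
    (M := ModuleCat.of A (A ⧸ I)) (N := ModuleCat.of A A) (rs := zs)
    (fun z hz => by
      rw [Ideal.annihilator_quotient, hI]
      exact Ideal.subset_span (List.mem_cons_of_mem l hz)) hzs
  obtain ⟨e'⟩ := nonempty_linearMap_quotient_equiv_ker (M := A ⧸ Ideal.ofList zs)
    (Ideal.annihilator_quotient (I := Ideal.ofList zs)).ge l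
  rw [← hcodim] at e
  exact ⟨e.trans ((LinearEquiv.arrowCongr
    (Submodule.quotEquivOfEq _ _ (by rw [hI, Ideal.ofList_cons]))
    (Submodule.quotEquivOfEq _ _ (by rw [smul_eq_mul, Ideal.mul_top]))).trans e')⟩

theorem nonempty_ker_lsmul_equiv {M N : Type*} [AddCommGroup M] [Module A M] [AddCommGroup N]
    [Module A N] (e : M ≃ₗ[A] N) (l : A) :
    Nonempty (LinearMap.ker (LinearMap.lsmul A M l) ≃ₗ[A]
      LinearMap.ker (LinearMap.lsmul A N l)) := by
  have hmap : LinearMap.ker (LinearMap.lsmul A M l) =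
      (LinearMap.ker (LinearMap.lsmul A N l)).comap e.toLinearMap := by
    ext m
    simp [← map_smul]
  exact ⟨(LinearEquiv.ofEq _ _ hmap).trans (e.ofSubmodule' _)⟩

theorem nonempty_quotient_smul_top_equiv (I J : Ideal A) :
    Nonempty (((A ⧸ J) ⧸ (I • ⊤ : Submodule A (A ⧸ J))) ≃ₗ[A] (A ⧸ (I ⊔ J))) := by
  have hmap : (I • ⊤ : Submodule A (A ⧸ J)) = Submodule.map J.mkQ I := by
    rw [← Submodule.range_mkQ, ← Submodule.map_top, ← Submodule.map_smul'', smul_eq_mul,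
      Ideal.mul_top]
  exact ⟨(Submodule.quotEquivOfEq _ _ hmap).trans
    ((Submodule.quotientQuotientEquivQuotientSup J I).trans
      (Submodule.quotEquivOfEq _ _ (sup_comm _ _)))⟩

theorem quotientCodim_eq {I : Ideal A} {a b : ℕ} (hA : ringKrullDim A = (a + b : ℕ))
    (hI : ringKrullDim (A ⧸ I) = a) : quotientCodim I = b := by
  have hA' : (ringKrullDim A).unbotD 0 = (a + b : ℕ) := by rw [hA]; rfl
  have hI' : (ringKrullDim (A ⧸ I)).unbotD 0 = (a : ℕ∞) := by rw [hI]; rfl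
  rw [quotientCodim, hA', hI', ← ENat.natCast_sub, ENat.toNat_natCast, Nat.add_sub_cancel_left]

end CanonicalModuleAsKernel

section LengthExact

theorem length_lt_iff_ne_zero_of_exact {A : Type*} [CommRing A] {M N P : Type*} [AddCommGroup M]
    [Module A M] [AddCommGroup N] [Module A N] [AddCommGroup P] [Module A P]
    (hN : IsFiniteLength A N) {f : M →ₗ[A] N} {g : N →ₗ[A] P} (hf : Function.Injective f)
    (hfg : Function.Exact f g) : Module.length A M < Module.length A N ↔ g ≠ 0 := by
  obtain ⟨_, _⟩ := isFiniteLength_iff_isNoetherian_isArtinian.mp hN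
  rw [(LinearEquiv.ofInjective f hf).length_eq, ← hfg.linearMap_ker_eq, Ne, ← LinearMap.ker_eq_top]
  exact ⟨fun hlt htop => hlt.ne (by rw [htop, Module.length_top]), fun h => Submodule.length_lt h⟩

end LengthExact

section AlmostCompleteIntersection

open IsLocalRing RingTheory.Sequence

variable {A : Type*} [CommRing A]

theorem exact_lsmul_factor {I J : Ideal A} {l : A} (hI : I = Ideal.span {l} ⊔ J) :
    Function.Exact (LinearMap.lsmul A (A ⧸ J) l)
      (Submodule.factor (le_sup_right.trans_eq hI.symm)) := by
  refine LinearMap.exact_iff.mpr (le_antisymm (fun v hv => ?_) ?_)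
  · obtain ⟨a, rfl⟩ := Submodule.mkQ_surjective _ v
    have ha : a ∈ I := (Submodule.Quotient.mk_eq_zero _).mp hv
    rw [hI] at ha
    obtain ⟨c, b, hb, rfl⟩ := Ideal.mem_span_singleton_sup.mp ha
    refine ⟨J.mkQ c, ?_⟩
    rw [LinearMap.lsmul_apply, ← map_smul, smul_eq_mul, mul_comm, map_add, left_eq_add]
    exact (Submodule.Quotient.mk_eq_zero J).mpr hb
  · rintro _ ⟨v, rfl⟩
    obtain ⟨a, rfl⟩ := Submodule.mkQ_surjective _ v
    refine (Submodule.Quotient.mk_eq_zero _).mpr (Ideal.mul_mem_right _ _ ?_)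
    exact hI ▸ Ideal.mem_sup_left (Ideal.mem_span_singleton_self l)

theorem ofList_cons_le_annihilator {ys : List A} {l : A} {W : Type*} [AddCommGroup W]
    [Module A W] {ι : W →ₗ[A] A ⧸ Ideal.ofList ys} (hι : Function.Injective ι)
    (hιl : Function.Exact ι (LinearMap.lsmul A (A ⧸ Ideal.ofList ys) l)) :
    Ideal.ofList (l :: ys) ≤ Module.annihilator A W := by
  rw [Ideal.ofList_cons, sup_le_iff, Ideal.span_singleton_le_iff_mem, Module.mem_annihilator]
  constructor
  · intro w
    exact hι (by rw [map_smul, map_zero]; exact hιl.apply_apply_eq_zero w)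
  · exact Ideal.annihilator_quotient.ge.trans (ι.annihilator_le_of_injective hι)

theorem not_isSMulRegular_of_height_le [IsNoetherianRing A] {ys : List A} {l : A}
    (hys : IsWeaklyRegular A ys) (hheight : (Ideal.ofList (l :: ys)).height ≤ ys.length) :
    ¬ IsSMulRegular (A ⧸ Ideal.ofList ys) l := by
  intro hl
  have hregular : IsWeaklyRegular A (ys ++ [l]) := by
    rw [isWeaklyRegular_append_iff, isWeaklyRegular_singleton_iff]
    exact ⟨hys, ((Submodule.quotEquivOfEq _ _
      (by rw [smul_eq_mul, Ideal.mul_top])).isSMulRegular_congr l).mpr hl⟩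
  have hle := length_le_height_of_isWeaklyRegular (I := Ideal.ofList (l :: ys))
    (fun r hr => Ideal.subset_span (List.perm_append_singleton l ys |>.subset hr)) hregular
  simpa using Nat.cast_le.mp (hle.trans hheight)

variable [IsLocalRing A] [IsNoetherianRing A] {d : ℕ} {x : Fin d → A} {ys : List A} {l : A}

namespace IsMaximalRegularSequence

theorem maximalIdeal_le_radical_sup (h : IsMaximalRegularSequence x ys) (l : A) :
    maximalIdeal A ≤ (Ideal.span (Set.range x) ⊔ Ideal.ofList (l :: ys)).radical := by
  refine h.maximalIdeal_le_radical.trans (Ideal.radical_mono (sup_le_sup_left ?_ _))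
  rw [Ideal.ofList_cons]
  exact le_sup_right

section Kernel

variable {W : Type*} [AddCommGroup W] [Module A W] {ι : W →ₗ[A] A ⧸ Ideal.ofList ys}

theorem maximalIdeal_le_radical_annihilator (h : IsMaximalRegularSequence x ys)
    (hι : Function.Injective ι)
    (hιl : Function.Exact ι (LinearMap.lsmul A (A ⧸ Ideal.ofList ys) l)) :
    maximalIdeal A ≤ (Ideal.span (Set.range x) ⊔ Module.annihilator A W).radical :=
  (h.maximalIdeal_le_radical_sup l).trans
    (Ideal.radical_mono (sup_le_sup_left (ofList_cons_le_annihilator hι hιl) _))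

theorem isFiniteLength_quotient_smul_top (h : IsMaximalRegularSequence x ys)
    (hι : Function.Injective ι)
    (hιl : Function.Exact ι (LinearMap.lsmul A (A ⧸ Ideal.ofList ys) l)) :
    IsFiniteLength A (W ⧸ (Ideal.span (Set.range x) • ⊤ : Submodule A W)) := by
  have := Module.Finite.of_injective ι hι
  refine isFiniteLength_of_maximalIdeal_le_radical_annihilator
    ((h.maximalIdeal_le_radical_annihilator hι hιl).trans (Ideal.radical_mono (sup_le ?_ ?_)))
  · intro a ha
    rw [Module.mem_annihilator]
    exact (Submodule.mkQ_surjective _).forall.mpr fun w =>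
      (Submodule.Quotient.mk_eq_zero _).mpr (Submodule.smul_mem_smul ha trivial)
  · exact LinearMap.annihilator_le_of_surjective _ (Submodule.mkQ_surjective _)

theorem exists_four_term_exact (h : IsMaximalRegularSequence x ys)
    (hι : Function.Injective ι)
    (hιl : Function.Exact ι (LinearMap.lsmul A (A ⧸ Ideal.ofList ys) l))
    {V : Type*} [AddCommGroup V] [Module A V]
    (ε : V ≃ₗ[A] LinearMap.ker
      (KoszulHomology.map x (LinearMap.lsmul A (A ⧸ Ideal.ofList ys) l) 0)) :
    ∃ (f : KoszulHomology x (A ⧸ Ideal.ofList (l :: ys)) 2 →ₗ[A]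
          W ⧸ (Ideal.span (Set.range x) • ⊤ : Submodule A W))
      (g : (W ⧸ (Ideal.span (Set.range x) • ⊤ : Submodule A W)) →ₗ[A] V)
      (k : V →ₗ[A] KoszulHomology x (A ⧸ Ideal.ofList (l :: ys)) 1),
      Function.Injective f ∧ Function.Exact f g ∧ Function.Exact g k ∧ Function.Surjective k :=
  KoszulHomology.exists_four_term_exact x hι hιl (exact_lsmul_factor (Ideal.ofList_cons l ys))
    (Submodule.factor_surjective _) (fun _ => h.subsingleton_koszulHomology)
    (fun _ => h.subsingleton_koszulHomology) (KoszulHomology.zeroEquiv x W) ε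

theorem nonempty_koszulHomology_equiv (h : IsMaximalRegularSequence x ys)
    (hι : Function.Injective ι)
    (hιl : Function.Exact ι (LinearMap.lsmul A (A ⧸ Ideal.ofList ys) l)) {p : ℕ} (hp : p ≠ 0) :
    Nonempty (KoszulHomology x (A ⧸ Ideal.ofList (l :: ys)) (p + 2) ≃ₗ[A] KoszulHomology x W p) :=
  KoszulHomology.nonempty_equiv_add_two x hι hιl (exact_lsmul_factor (Ideal.ofList_cons l ys))
    (Submodule.factor_surjective _) (fun _ => h.subsingleton_koszulHomology)
    (fun _ => h.subsingleton_koszulHomology) hp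

end Kernel

end IsMaximalRegularSequence

/-- The ideal `(l, ys)` is an almost complete intersection of height `#ys`, and `x₁, …, x_d, ys` is
a maximal regular sequence. In the notation of the paper, `ys = y₁, …, y_{s-1}` and `l = y_s`. -/
structure IsAlmostCompleteIntersection (x : Fin d → A) (ys : List A) (l : A) : Prop
    extends IsMaximalRegularSequence x ys where
  height_eq : (Ideal.ofList (l :: ys)).height = ys.length

namespace IsAlmostCompleteIntersection

omit [IsNoetherianRing A] in
theorem ofList_cons_ne_top (h : IsAlmostCompleteIntersection x ys l) :
    Ideal.ofList (l :: ys) ≠ ⊤ := fun htop => by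
  simpa [htop] using h.height_eq

theorem not_isSMulRegular (h : IsAlmostCompleteIntersection x ys l) :
    ¬ IsSMulRegular (A ⧸ Ideal.ofList ys) l :=
  not_isSMulRegular_of_height_le h.isRegular_ys.toIsWeaklyRegular h.height_eq.le

/- As `l` is a zero divisor on the Cohen-Macaulay ring `A/(ys)`, it lies in an associated prime `p`
of that ring, and `A/p` has full dimension. -/
theorem ringKrullDim_quotient_ofList_cons (h : IsAlmostCompleteIntersection x ys l) :
    ringKrullDim (A ⧸ Ideal.ofList (l :: ys)) = d := by
  have hx : ∀ r ∈ List.ofFn x, r ∈ maximalIdeal A :=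
    List.forall_mem_ofFn_iff.mpr h.mem_maximalIdeal
  obtain ⟨p, hp, hlp⟩ := exists_mem_associatedPrimes_of_not_isSMulRegular h.not_isSMulRegular
  have hle : Ideal.ofList (l :: ys) ≤ p := by
    rw [Ideal.ofList_cons, sup_le_iff, Ideal.span_singleton_le_iff_mem]
    exact ⟨hlp, by
      simpa only [Submodule.annihilator_top, Ideal.annihilator_quotient] using
        IsAssociatedPrime.annihilator_le hp⟩
  refine le_antisymm ?_ ?_
  · simpa using ringKrullDim_quotient_le_length_of_maximalIdeal_le_radical hx h.ofList_cons_ne_top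
      (by rw [ofList_ofFn]; exact h.maximalIdeal_le_radical_sup l)
  · refine le_trans ?_ (ringKrullDim_le_of_surjective (Ideal.Quotient.factor hle)
      (Ideal.Quotient.factor_surjective hle))
    simpa using length_le_ringKrullDim_quotient_of_mem_associatedPrimes hp hx
      h.isWeaklyRegular_quotient

theorem isSystemOfParameters (h : IsAlmostCompleteIntersection x ys l) :
    IsSystemOfParameters fun i => Ideal.Quotient.mk (Ideal.ofList (l :: ys)) (x i) :=
  isSystemOfParameters_mk h.ofList_cons_ne_top h.mem_maximalIdeal
    h.ringKrullDim_quotient_ofList_cons (h.maximalIdeal_le_radical_sup l)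

theorem ringKrullDim_quotient_sup_eq_zero (h : IsAlmostCompleteIntersection x ys l) :
    ringKrullDim (A ⧸ (Ideal.ofList (l :: ys) ⊔ Ideal.span (Set.range x))) = 0 := by
  have hle : Ideal.span (Set.range x) ⊔ Ideal.ofList ys ≤
      Ideal.ofList (l :: ys) ⊔ Ideal.span (Set.range x) := by
    rw [sup_comm, Ideal.ofList_cons]
    exact sup_le_sup_right le_sup_right _
  have hmax : Ideal.ofList (l :: ys) ⊔ Ideal.span (Set.range x) ≤ maximalIdeal A :=
    sup_le (le_maximalIdeal h.ofList_cons_ne_top)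
      (Ideal.span_le.mpr (Set.range_subset_iff.mpr h.mem_maximalIdeal))
  have := Ideal.Quotient.nontrivial_iff.mpr
    (ne_top_of_le_ne_top (maximalIdeal.isMaximal A).ne_top hmax)
  refine le_antisymm ?_ ringKrullDim_nonneg_of_nontrivial
  exact (ringKrullDim_le_of_surjective (Ideal.Quotient.factor hle)
    (Ideal.Quotient.factor_surjective hle)).trans h.ringKrullDim_quotient_eq_zero.le

section Kernel

variable {W : Type*} [AddCommGroup W] [Module A W] {ι : W →ₗ[A] A ⧸ Ideal.ofList ys}

theorem nontrivial_of_exact (h : IsAlmostCompleteIntersection x ys l)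
    (hιl : Function.Exact ι (LinearMap.lsmul A (A ⧸ Ideal.ofList ys) l)) : Nontrivial W := by
  by_contra! hW
  refine h.not_isSMulRegular (IsSMulRegular.of_right_eq_zero_of_smul fun v hv => ?_)
  obtain ⟨w, rfl⟩ := (hιl v).mp hv
  rw [Subsingleton.elim w 0, map_zero]

theorem moduleDepth_eq_min (h : IsAlmostCompleteIntersection x ys l)
    (hι : Function.Injective ι)
    (hιl : Function.Exact ι (LinearMap.lsmul A (A ⧸ Ideal.ofList ys) l)) :
    moduleDepth A W = min (d : ℕ∞) (moduleDepth A (A ⧸ Ideal.ofList (l :: ys)) + 2) := by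
  have := Ideal.Quotient.nontrivial_iff.mpr h.ofList_cons_ne_top
  have := Module.Finite.of_injective ι hι
  have := h.nontrivial_of_exact hιl
  refine moduleDepth_eq_min_of_koszulHomology_shift _ W h.mem_maximalIdeal
    (by rw [Ideal.annihilator_quotient]; exact h.maximalIdeal_le_radical_sup l)
    (h.maximalIdeal_le_radical_annihilator hι hιl) fun p hp => ?_
  obtain ⟨e⟩ := h.nonempty_koszulHomology_equiv hι hιl hp
  exact e.subsingleton_congr

end Kernel

end IsAlmostCompleteIntersection

end AlmostCompleteIntersection

section GorensteinAlmostCompleteIntersection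

open IsLocalRing CategoryTheory.Abelian

variable {A : Type u} [CommRing A] [IsLocalRing A] [IsNoetherianRing A] {d : ℕ} {x : Fin d → A}
  {ys : List A} {l : A}

namespace IsMaximalRegularSequence

theorem satisfiesMonomialConjecture_iff_length_lt (h : IsMaximalRegularSequence x ys)
    (hA : Module.length A (Ext.{u} (ModuleCat.of A (A ⧸ maximalIdeal A)) (ModuleCat.of A A)
      (d + ys.length)) ≤ 1)
    {W : Type*} [AddCommGroup W] [Module A W] {ι : W →ₗ[A] A ⧸ Ideal.ofList ys}
    (hι : Function.Injective ι)
    (hιl : Function.Exact ι (LinearMap.lsmul A (A ⧸ Ideal.ofList ys) l)) :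
    SatisfiesMonomialConjecture
        (fun i => Ideal.Quotient.mk (Ideal.ofList (l :: ys)) (x i)) ↔
      Module.length A (KoszulHomology x (A ⧸ Ideal.ofList (l :: ys)) 2) <
        Module.length A (W ⧸ (Ideal.span (Set.range x) • ⊤ : Submodule A W)) := by
  obtain ⟨f, hf, hfι⟩ := KoszulHomology.exists_injective_exact_map x hι hιl
    (exact_lsmul_factor (Ideal.ofList_cons l ys)) (Submodule.factor_surjective _)
    (fun _ => h.subsingleton_koszulHomology) (fun _ => h.subsingleton_koszulHomology) 0
  have hfl := (h.isFiniteLength_quotient_smul_top hι hιl).of_surjective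
    (KoszulHomology.zeroEquiv x W).surjective
  rw [(KoszulHomology.zeroEquiv x W).length_eq, length_lt_iff_ne_zero_of_exact hfl hf hfι,
    h.satisfiesMonomialConjecture_iff hA l, hιl.linearMap_ker_eq, LinearMap.range_le_iff_comap,
    Ne, KoszulHomology.map_zero_eq_zero_iff, Submodule.eq_top_iff']
  rfl

end IsMaximalRegularSequence

namespace IsAlmostCompleteIntersection

theorem exists_injective_exact_canonicalModule (h : IsAlmostCompleteIntersection x ys l) :
    ∃ ι : CanonicalModule (Ideal.ofList (l :: ys)) →ₗ[A] A ⧸ Ideal.ofList ys,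
      Function.Injective ι ∧ Function.Exact ι (LinearMap.lsmul A (A ⧸ Ideal.ofList ys) l) := by
  obtain ⟨e⟩ := nonempty_canonicalModule_equiv_ker rfl h.isRegular_ys
    (quotientCodim_eq h.ringKrullDim_eq h.ringKrullDim_quotient_ofList_cons)
  refine ⟨Submodule.subtype _ ∘ₗ e.toLinearMap, Subtype.val_injective.comp e.injective, ?_⟩
  rw [LinearMap.exact_iff, LinearMap.range_comp, LinearEquiv.range, Submodule.map_subtype_top]

theorem nonempty_canonicalModule_sup_equiv (h : IsAlmostCompleteIntersection x ys l) :
    Nonempty (CanonicalModule (Ideal.ofList (l :: ys) ⊔ Ideal.span (Set.range x)) ≃ₗ[A]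
      LinearMap.ker (KoszulHomology.map x (LinearMap.lsmul A (A ⧸ Ideal.ofList ys) l) 0)) := by
  have hsup : Ideal.ofList (l :: ys) ⊔ Ideal.span (Set.range x) =
      Ideal.ofList (l :: (List.ofFn x ++ ys)) := by
    rw [Ideal.ofList_cons, Ideal.ofList_cons, Ideal.ofList_append, ofList_ofFn, sup_assoc,
      sup_comm (Ideal.ofList ys)]
  have hdim : ringKrullDim A = (0 + (List.ofFn x ++ ys).length : ℕ) := by
    rw [h.ringKrullDim_eq, zero_add, List.length_append, List.length_ofFn]
  obtain ⟨e⟩ := nonempty_canonicalModule_equiv_ker hsup h.isRegular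
    (quotientCodim_eq hdim h.ringKrullDim_quotient_sup_eq_zero)
  have hspan : Ideal.ofList (List.ofFn x ++ ys) =
      Ideal.span (Set.range x) ⊔ Ideal.ofList ys := by rw [Ideal.ofList_append, ofList_ofFn]
  obtain ⟨eQuotient⟩ :=
    nonempty_quotient_smul_top_equiv (Ideal.span (Set.range x)) (Ideal.ofList ys)
  obtain ⟨eKer⟩ := nonempty_ker_lsmul_equiv ((Submodule.quotEquivOfEq _ _ hspan).trans
    (eQuotient.symm.trans (KoszulHomology.zeroEquiv x (A ⧸ Ideal.ofList ys)))) l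
  have hmap : KoszulHomology.map x (LinearMap.lsmul A (A ⧸ Ideal.ofList ys) l) 0 =
      LinearMap.lsmul A (KoszulHomology x (A ⧸ Ideal.ofList ys) 0) l :=
    LinearMap.ext fun c => KoszulHomology.map_lsmul_apply x l c
  rw [hmap]
  exact ⟨e.trans eKer⟩

end IsAlmostCompleteIntersection

end GorensteinAlmostCompleteIntersection

theorem span_range_eq_ofList {A : Type*} [CommRing A] {n : ℕ} (y : Fin (n + 1) → A) :
    Ideal.span (Set.range y) =
      Ideal.ofList (y (Fin.last n) :: List.ofFn (Fin.init y)) := by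
  rw [Ideal.ofList_cons, ofList_ofFn, ← Ideal.span_insert, ← Fin.range_snoc, Fin.snoc_init_self]

/- As `A` is Cohen-Macaulay of dimension `d + n`, the bound `hA` says that `A` is Gorenstein. -/
theorem lemma4p1_general {A : Type u} [CommRing A] [IsLocalRing A] [IsNoetherianRing A] {d n : ℕ}
    (x : Fin d → A) (y : Fin (n + 1) → A) (𝔞 𝔟 : Ideal A)
    (h𝔞 : 𝔞 = Ideal.span (Set.range x)) (h𝔟 : 𝔟 = Ideal.span (Set.range y))
    (hht𝔟 : 𝔟.height = n)
    (hreg : RingTheory.Sequence.IsRegular A (List.ofFn x ++ List.ofFn (Fin.init y)))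
    (hdim : ringKrullDim A = ((d + n : ℕ) : WithBot ℕ∞))
    (hA : Module.length A (CategoryTheory.Abelian.Ext.{u}
      (ModuleCat.of A (A ⧸ IsLocalRing.maximalIdeal A)) (ModuleCat.of A A) (d + n)) ≤ 1) :
    -- (i)
    (∃ (f : KoszulHomology x (A ⧸ 𝔟) 2 →ₗ[A]
            CanonicalModule 𝔟 ⧸ (𝔞 • ⊤ : Submodule A (CanonicalModule 𝔟)))
        (g : (CanonicalModule 𝔟 ⧸ (𝔞 • ⊤ : Submodule A (CanonicalModule 𝔟))) →ₗ[A]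
            CanonicalModule (𝔟 ⊔ 𝔞))
        (h : CanonicalModule (𝔟 ⊔ 𝔞) →ₗ[A] KoszulHomology x (A ⧸ 𝔟) 1),
        Function.Injective f ∧ Function.Exact f g ∧ Function.Exact g h ∧
          Function.Surjective h) ∧
    -- (ii)
    (∀ i : ℕ, 3 ≤ i → Nonempty
        (KoszulHomology x (A ⧸ 𝔟) i ≃ₗ[A] KoszulHomology x (CanonicalModule 𝔟) (i - 2))) ∧
    (moduleDepth A (A ⧸ 𝔟) + 2 ≤ d →
        moduleDepth A (CanonicalModule 𝔟) = moduleDepth A (A ⧸ 𝔟) + 2) ∧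
    ((d : ℕ∞) ≤ moduleDepth A (A ⧸ 𝔟) + 1 → moduleDepth A (CanonicalModule 𝔟) = d) ∧
    -- (iii)
    IsSystemOfParameters (fun i => Ideal.Quotient.mk 𝔟 (x i)) ∧
    (SatisfiesMonomialConjecture (fun i => Ideal.Quotient.mk 𝔟 (x i)) ↔
        Module.length A (KoszulHomology x (A ⧸ 𝔟) 2) <
          Module.length A
            (CanonicalModule 𝔟 ⧸ (𝔞 • ⊤ : Submodule A (CanonicalModule 𝔟)))) ∧
    (∀ (f : KoszulHomology x (A ⧸ 𝔟) 2 →ₗ[A]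
            CanonicalModule 𝔟 ⧸ (𝔞 • ⊤ : Submodule A (CanonicalModule 𝔟)))
        (g : (CanonicalModule 𝔟 ⧸ (𝔞 • ⊤ : Submodule A (CanonicalModule 𝔟))) →ₗ[A]
            CanonicalModule (𝔟 ⊔ 𝔞))
        (h : CanonicalModule (𝔟 ⊔ 𝔞) →ₗ[A] KoszulHomology x (A ⧸ 𝔟) 1),
        Function.Injective f → Function.Exact f g → Function.Exact g h →
          Function.Surjective h →
        (SatisfiesMonomialConjecture (fun i => Ideal.Quotient.mk 𝔟 (x i)) ↔ g ≠ 0)) := by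
  subst h𝔞
  obtain ⟨ys, l, hy, hlength, hys⟩ : ∃ (ys : List A) (l : A), Ideal.span (Set.range y) =
      Ideal.ofList (l :: ys) ∧ ys.length = n ∧ List.ofFn (Fin.init y) = ys :=
    ⟨_, _, span_range_eq_ofList y, by simp, rfl⟩
  rw [hys] at hreg
  rw [hy] at h𝔟
  clear hy hys y
  subst h𝔟 hlength
  have h : IsAlmostCompleteIntersection x ys l := ⟨⟨hreg, hdim⟩, hht𝔟⟩
  obtain ⟨ι, hι, hιl⟩ := h.exists_injective_exact_canonicalModule
  obtain ⟨ε⟩ := h.nonempty_canonicalModule_sup_equiv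
  have hdepth := h.moduleDepth_eq_min hι hιl
  have hmc := h.satisfiesMonomialConjecture_iff_length_lt hA hι hιl
  have hfl := h.isFiniteLength_quotient_smul_top hι hιl
  refine ⟨h.exists_four_term_exact hι hιl ε, fun i hi => ?_,
    fun hd => hdepth.trans (min_eq_right hd), fun hd => hdepth.trans (min_eq_left ?_),
    h.isSystemOfParameters, hmc,
    fun f g _ hf hfg _ _ => hmc.trans (length_lt_iff_ne_zero_of_exact hfl hf hfg)⟩
  · obtain ⟨p, rfl⟩ : ∃ p, i = p + 2 := ⟨i - 2, by lia⟩
    exact h.nonempty_koszulHomology_equiv hι hιl (by lia)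
  · exact hd.trans (add_le_add_right one_le_two _)

theorem lemma4p1 {A : Type u} [CommRing A] [IsRegularLocalRing A] {d n : ℕ}
    (x : Fin d → A) (y : Fin (n + 1) → A) (𝔞 𝔟 : Ideal A)
    (h𝔞 : 𝔞 = Ideal.span (Set.range x)) (h𝔟 : 𝔟 = Ideal.span (Set.range y))
    (hht𝔞 : 𝔞.height = d) (hht𝔟 : 𝔟.height = n)
    (hreg : RingTheory.Sequence.IsRegular A (List.ofFn x ++ List.ofFn (Fin.init y)))
    (hdim : ringKrullDim A = ((d + n : ℕ) : WithBot ℕ∞)) :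
    -- (i)
    (∃ (f : KoszulHomology x (A ⧸ 𝔟) 2 →ₗ[A]
            CanonicalModule 𝔟 ⧸ (𝔞 • ⊤ : Submodule A (CanonicalModule 𝔟)))
        (g : (CanonicalModule 𝔟 ⧸ (𝔞 • ⊤ : Submodule A (CanonicalModule 𝔟))) →ₗ[A]
            CanonicalModule (𝔟 ⊔ 𝔞))
        (h : CanonicalModule (𝔟 ⊔ 𝔞) →ₗ[A] KoszulHomology x (A ⧸ 𝔟) 1),
        Function.Injective f ∧ Function.Exact f g ∧ Function.Exact g h ∧
          Function.Surjective h) ∧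
    -- (ii)
    (∀ i : ℕ, 3 ≤ i → Nonempty
        (KoszulHomology x (A ⧸ 𝔟) i ≃ₗ[A] KoszulHomology x (CanonicalModule 𝔟) (i - 2))) ∧
    (moduleDepth A (A ⧸ 𝔟) + 2 ≤ d →
        moduleDepth A (CanonicalModule 𝔟) = moduleDepth A (A ⧸ 𝔟) + 2) ∧
    ((d : ℕ∞) ≤ moduleDepth A (A ⧸ 𝔟) + 1 → moduleDepth A (CanonicalModule 𝔟) = d) ∧
    -- (iii)
    IsSystemOfParameters (fun i => Ideal.Quotient.mk 𝔟 (x i)) ∧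
    (SatisfiesMonomialConjecture (fun i => Ideal.Quotient.mk 𝔟 (x i)) ↔
        Module.length A (KoszulHomology x (A ⧸ 𝔟) 2) <
          Module.length A
            (CanonicalModule 𝔟 ⧸ (𝔞 • ⊤ : Submodule A (CanonicalModule 𝔟)))) ∧
    (∀ (f : KoszulHomology x (A ⧸ 𝔟) 2 →ₗ[A]
            CanonicalModule 𝔟 ⧸ (𝔞 • ⊤ : Submodule A (CanonicalModule 𝔟)))
        (g : (CanonicalModule 𝔟 ⧸ (𝔞 • ⊤ : Submodule A (CanonicalModule 𝔟))) →ₗ[A]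
            CanonicalModule (𝔟 ⊔ 𝔞))
        (h : CanonicalModule (𝔟 ⊔ 𝔞) →ₗ[A] KoszulHomology x (A ⧸ 𝔟) 1),
        Function.Injective f → Function.Exact f g → Function.Exact g h →
          Function.Surjective h →
        (SatisfiesMonomialConjecture (fun i => Ideal.Quotient.mk 𝔟 (x i)) ↔ g ≠ 0)) := by
  have hlength : d + n = (List.ofFn x ++ List.ofFn (Fin.init y)).length := by simp
  exact lemma4p1_general x y 𝔞 𝔟 h𝔞 h𝔟 hht𝔟 hreg hdim
    (hlength ▸ length_ext_residueField_le_one hreg (hlength ▸ hdim))
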